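/- Let $n\ge 1$ and let $t_1,t_2,t_3>0$. Let $S^{4n+3}$ be the unit sphere in $\mathbb{H}^{n+1}$, let $S^3$ (the unit quaternions) act on it by right multiplication, so that the orbits are the fibres of the Hopf fibration $S^3\to S^{4n+3}\to\mathbb{HP}^n$, and let $X_1,X_2,X_3$ be the vertical vector fields $X_1(p)=p\,i$, $X_2(p)=p\,j$, $X_3(p)=p\,k$. Let $g_{(t_1,t_2,t_3)}$ be the Riemannian metric on $S^{4n+3}$ that agrees with the round metric of curvature $1$ on the orthogonal complement of the fibres, for which this complement stays orthogonal to the fibres, and for which $X_1,X_2,X_3$ are orthogonal with squared lengths $t_1,t_2,t_3$. For every cyclic permutation $(i,j,k)$ of $(1,2,3)$ put $$V_i=\frac{t_j^2+t_k^2-3t_i^2+2t_it_j+2t_it_k-2t_jt_k}{t_i},\qquad H_i=4-3t_i .$$ Then $g_{(t_1,t_2,t_3)}$ has positive sectional curvature if and only if, for every cyclic permutation $(i,j,k)$ of $(1,2,3)$, $$V_i>0,\qquad H_i>0,\qquad 3\,|t_jt_k-t_j-t_k+t_i|<t_jt_k+\sqrt{H_iV_i}.$$ -/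

import Mathlib

open Module Bundle Metric
open scoped Manifold ContDiff Quaternion InnerProductSpace

/-- The pull-back `(u, v) ↦ B (d u) (d v)` of a continuous bilinear form along a continuous
linear map. -/
noncomputable def pullbackForm {T T' : Type*} [AddCommGroup T] [Module ℝ T] [TopologicalSpace T]
    [AddCommGroup T'] [Module ℝ T'] [TopologicalSpace T']
    (B : T' →L[ℝ] T' →L[ℝ] ℝ) (d : T →L[ℝ] T') : T →L[ℝ] T →L[ℝ] ℝ :=
  (ContinuousLinearMap.precomp ℝ d).comp (B.comp d)

theorem pullbackForm_apply {T T' : Type*} [AddCommGroup T] [Module ℝ T] [TopologicalSpace T]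
    [AddCommGroup T'] [Module ℝ T'] [TopologicalSpace T']
    (B : T' →L[ℝ] T' →L[ℝ] ℝ) (d : T →L[ℝ] T') (u v : T) :
    pullbackForm B d u v = B (d u) (d v) := rfl

section Curvature

variable {E : Type*} [NormedAddCommGroup E] [NormedSpace ℝ E]

/-- The Christoffel symbol `Γ x (u, v)` of a metric `G` on an open piece of the vector space `E`:
the vector with `G x (Γ (u, v), w) = ½ (∂_u G (v, w) + ∂_v G (u, w) - ∂_w G (u, v))` for all `w`.
It is `∇_u v` for the constant vector fields `u`, `v` and the Levi-Civita connection `∇` of `G`. -/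
noncomputable def christoffel (G : E → E →L[ℝ] E →L[ℝ] ℝ) (x u v : E) : E :=
  (G x).inverse ((1 / 2 : ℝ) •
    (fderiv ℝ G x u v + fderiv ℝ G x v u - ((fderiv ℝ G x).flip u).flip v))

/-- The Riemann tensor `R(u, v) w = ∇_u ∇_v w - ∇_v ∇_u w` of `G` at `x`, for constant (hence
commuting) vector fields `u`, `v`, `w`. -/
noncomputable def riemannTensor (G : E → E →L[ℝ] E →L[ℝ] ℝ) (x u v w : E) : E :=
  fderiv ℝ (fun y => christoffel G y v w) x u - fderiv ℝ (fun y => christoffel G y u w) x v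
    + christoffel G x u (christoffel G x v w) - christoffel G x v (christoffel G x u w)

/-- The sectional curvature `G(R(u, v) v, u) / (G(u, u) G(v, v) - G(u, v)²)` at `x`. -/
noncomputable def sectionalCurvatureOfForm (G : E → E →L[ℝ] E →L[ℝ] ℝ) (x u v : E) : ℝ :=
  G x (riemannTensor G x u v v) u / (G x u u * G x v v - G x u v ^ 2)

variable {M : Type*} [TopologicalSpace M] [ChartedSpace E M] [IsManifold 𝓘(ℝ, E) ∞ M]

/-- A Riemannian metric on a manifold, read in the chart at `p`. -/
noncomputable def coordMetric
    (g : ContMDiffRiemannianMetric 𝓘(ℝ, E) ∞ E (fun x : M => TangentSpace 𝓘(ℝ, E) x))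
    (p : M) (x : E) : E →L[ℝ] E →L[ℝ] ℝ :=
  pullbackForm (T := E) (g.inner ((extChartAt 𝓘(ℝ, E) p).symm x))
    (mfderiv 𝓘(ℝ, E) 𝓘(ℝ, E) (extChartAt 𝓘(ℝ, E) p).symm x)

/-- The sectional curvature at `p` of the plane spanned by the tangent vectors `u`, `v`, computed in
the chart at `p`. -/
noncomputable def sectionalCurvature
    (g : ContMDiffRiemannianMetric 𝓘(ℝ, E) ∞ E (fun x : M => TangentSpace 𝓘(ℝ, E) x))
    (p : M) (u v : TangentSpace 𝓘(ℝ, E) p) : ℝ :=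
  sectionalCurvatureOfForm (coordMetric g p) (extChartAt 𝓘(ℝ, E) p p)
    (mfderiv 𝓘(ℝ, E) 𝓘(ℝ, E) (extChartAt 𝓘(ℝ, E) p) p u)
    (mfderiv 𝓘(ℝ, E) 𝓘(ℝ, E) (extChartAt 𝓘(ℝ, E) p) p v)

/-- All tangent planes at all points have positive sectional curvature. -/
def HasPositiveSectionalCurvature
    (g : ContMDiffRiemannianMetric 𝓘(ℝ, E) ∞ E (fun x : M => TangentSpace 𝓘(ℝ, E) x)) : Prop :=
  ∀ (p : M) (u v : TangentSpace 𝓘(ℝ, E) p), LinearIndependent ℝ ![u, v] →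
    0 < sectionalCurvature g p u v

end Curvature

/-- The quaternionic space `ℍⁿ⁺¹` with its standard Euclidean inner product over `ℝ`. -/
def QSpace (n : ℕ) : Type := PiLp 2 (fun _ : Fin (n + 1) => ℍ[ℝ])

noncomputable instance (n : ℕ) : NormedAddCommGroup (QSpace n) :=
  inferInstanceAs (NormedAddCommGroup (PiLp 2 (fun _ : Fin (n + 1) => ℍ[ℝ])))

noncomputable instance (n : ℕ) : InnerProductSpace ℝ (QSpace n) :=
  inferInstanceAs (InnerProductSpace ℝ (PiLp 2 (fun _ : Fin (n + 1) => ℍ[ℝ])))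

theorem QSpace.inner_def (n : ℕ) (p q : QSpace n) :
    ⟪p, q⟫_ℝ = ∑ s, ⟪p.ofLp s, q.ofLp s⟫_ℝ := rfl

theorem QSpace.finrank_eq (n : ℕ) : finrank ℝ (QSpace n) = (4 * n + 3) + 1 := by
  have h : finrank ℝ (QSpace n) = finrank ℝ (Fin (n + 1) → ℍ[ℝ]) :=
    (WithLp.linearEquiv 2 ℝ (Fin (n + 1) → ℍ[ℝ])).finrank_eq
  rw [h, Module.finrank_pi_fintype]
  simp [Quaternion.finrank_eq_four]; ring

instance (n : ℕ) : Fact (finrank ℝ (QSpace n) = (4 * n + 3) + 1) := ⟨QSpace.finrank_eq n⟩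

instance (n : ℕ) : FiniteDimensional ℝ (QSpace n) :=
  Module.finite_of_finrank_eq_succ (QSpace.finrank_eq n)

/-- The imaginary units `i, j, k`. -/
def imUnit : Fin 3 → ℍ[ℝ] := ![⟨0, 1, 0, 0⟩, ⟨0, 0, 1, 0⟩, ⟨0, 0, 0, 1⟩]

/-- The vector fields `p ↦ p i, p j, p k`, tangent to the fibres `p S³` of the Hopf fibration
`S⁴ⁿ⁺³ → ℍPⁿ`. On each fibre they are the left invariant fields of the group `S³` of unit
quaternions. -/
noncomputable def fibreField (n : ℕ) (i : Fin 3) : QSpace n →L[ℝ] QSpace n :=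
  LinearMap.toContinuousLinearMap
    { toFun := fun p => WithLp.toLp 2 fun s => p.ofLp s * imUnit i
      map_add' := fun p q => PiLp.ext fun s => add_mul (p.ofLp s) (q.ofLp s) (imUnit i)
      map_smul' := fun c p => PiLp.ext fun s => smul_mul_assoc c (p.ofLp s) (imUnit i) }

theorem fibreField_apply (n : ℕ) (i : Fin 3) (p : QSpace n) (s : Fin (n + 1)) :
    (fibreField n i p).ofLp s = p.ofLp s * imUnit i := rfl

theorem inner_fibreField (n : ℕ) (i j : Fin 3) (p : QSpace n) :
    ⟪fibreField n i p, fibreField n j p⟫_ℝ = if i = j then ‖p‖ ^ 2 else 0 := by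
  have key (i j : Fin 3) (q : ℍ[ℝ]) :
      ⟪q * imUnit i, q * imUnit j⟫_ℝ = if i = j then ⟪q, q⟫_ℝ else 0 := by
    fin_cases i <;> fin_cases j <;>
      simp only [imUnit, Quaternion.inner_def, Quaternion.re_mul, Quaternion.imI_mul,
        Quaternion.imJ_mul, Quaternion.imK_mul, Quaternion.re_star, Quaternion.imI_star,
        Quaternion.imJ_star, Quaternion.imK_star] <;> simp <;> ring
  rw [← real_inner_self_eq_norm_sq, QSpace.inner_def, QSpace.inner_def]
  simp only [fibreField_apply, key]
  split_ifs <;> simp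

/-- The Euclidean inner product of `ℍⁿ⁺¹` as a continuous bilinear form. -/
noncomputable def euclideanForm (n : ℕ) : QSpace n →L[ℝ] QSpace n →L[ℝ] ℝ := innerSL ℝ

theorem euclideanForm_apply (n : ℕ) (u v : QSpace n) : euclideanForm n u v = ⟪u, v⟫_ℝ := rfl

/-- The bilinear form `⟨u, v⟩ + ∑ᵢ (tᵢ - 1) ⟨p eᵢ, u⟩ ⟨p eᵢ, v⟩`. On the sphere, where the `p eᵢ`
are orthonormal for the round metric, the `p eᵢ` are orthogonal with length squared `tᵢ`, and
nothing changes on the orthogonal complement of the fibre, which remains orthogonal to it. -/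
noncomputable def ambientForm (n : ℕ) (t : Fin 3 → ℝ) (p : QSpace n) :
    QSpace n →L[ℝ] QSpace n →L[ℝ] ℝ :=
  euclideanForm n + ∑ i, (t i - 1) •
    (euclideanForm n (fibreField n i p)).smulRight (euclideanForm n (fibreField n i p))

theorem ambientForm_apply (n : ℕ) (t : Fin 3 → ℝ) (p u v : QSpace n) :
    ambientForm n t p u v =
      ⟪u, v⟫_ℝ + ∑ i, (t i - 1) * (⟪fibreField n i p, u⟫_ℝ * ⟪fibreField n i p, v⟫_ℝ) := by
  simp [ambientForm, euclideanForm_apply]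

theorem ambientForm_fibreField (n : ℕ) (t : Fin 3 → ℝ) (p : QSpace n) (hp : ‖p‖ = 1) (i : Fin 3)
    (v : QSpace n) :
    ambientForm n t p (fibreField n i p) v = t i * ⟪fibreField n i p, v⟫_ℝ := by
  simp only [ambientForm_apply, inner_fibreField, hp]
  simp
  ring

theorem ambientForm_pos (n : ℕ) (t : Fin 3 → ℝ) (ht : ∀ i, 0 < t i) (p : QSpace n)
    (hp : ‖p‖ = 1) (u : QSpace n) (hu : u ≠ 0) : 0 < ambientForm n t p u u := by
  have ho : Orthonormal ℝ fun i => fibreField n i p := by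
    rw [orthonormal_iff_ite]
    intro i j
    rw [inner_fibreField, hp]; simp
  have hb := ho.sum_inner_products_le (s := Finset.univ) u
  have hpos : 0 < ‖u‖ ^ 2 := by positivity
  rw [ambientForm_apply, real_inner_self_eq_norm_sq]
  simp only [Real.norm_eq_abs, sq_abs] at hb
  have hs : ∑ i, (t i - 1) * (⟪fibreField n i p, u⟫_ℝ * ⟪fibreField n i p, u⟫_ℝ) =
      ∑ i, t i * ⟪fibreField n i p, u⟫_ℝ ^ 2 - ∑ i, ⟪fibreField n i p, u⟫_ℝ ^ 2 := by
    rw [← Finset.sum_sub_distrib]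
    exact Finset.sum_congr rfl fun i _ => by ring
  rw [hs]
  have hnn : ∀ i ∈ Finset.univ, 0 ≤ t i * ⟪fibreField n i p, u⟫_ℝ ^ 2 := fun i _ =>
    mul_nonneg (ht i).le (sq_nonneg _)
  rcases (Finset.sum_nonneg hnn).eq_or_lt' with h0 | h0
  · have hz := (Finset.sum_eq_zero_iff_of_nonneg hnn).1 h0
    have hz' : ∑ i, ⟪fibreField n i p, u⟫_ℝ ^ 2 = 0 := Finset.sum_eq_zero fun i hi => by
      have := hz i hi
      rcases mul_eq_zero.1 this with h | h
      · exact absurd h (ht i).ne'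
      · exact h
    rw [h0, hz']; linarith
  · linarith

theorem ambientForm_contDiff (n : ℕ) (t : Fin 3 → ℝ) : ContDiff ℝ ∞ (ambientForm n t) := by
  rw [contDiff_clm_apply_iff]
  intro u
  rw [contDiff_clm_apply_iff]
  intro v
  simp only [ambientForm_apply]
  have h (i : Fin 3) (w : QSpace n) : ContDiff ℝ ∞ fun p => ⟪fibreField n i p, w⟫_ℝ :=
    (fibreField n i).contDiff.inner ℝ contDiff_const
  exact contDiff_const.add (ContDiff.sum fun i _ => contDiff_const.mul ((h i u).mul (h i v)))

theorem isVonNBounded_of_pos {F : Type*} [NormedAddCommGroup F] [NormedSpace ℝ F]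
    [FiniteDimensional ℝ F] (B : F →L[ℝ] F →L[ℝ] ℝ) (hB : ∀ v, v ≠ 0 → 0 < B v v) :
    Bornology.IsVonNBounded ℝ {v : F | B v v < 1} := by
  have hc : Continuous fun v => B v v := by fun_prop
  obtain ⟨c, hc0, hcB⟩ : ∃ c : ℝ, 0 < c ∧ ∀ v, ‖v‖ = 1 → c ≤ B v v := by
    rcases (sphere (0 : F) 1).eq_empty_or_nonempty with he | hne
    · refine ⟨1, one_pos, fun v hv => ?_⟩
      have : v ∈ sphere (0 : F) 1 := by simpa using hv
      simp [he] at this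
    · obtain ⟨w, hw, hmin⟩ := (isCompact_sphere (0 : F) 1).exists_isMinOn hne hc.continuousOn
      exact ⟨B w w, hB w (by rintro rfl; simp at hw), fun v hv => hmin (by simpa using hv)⟩
  rw [NormedSpace.isVonNBounded_iff]
  refine (isBounded_iff_forall_norm_le).2 ⟨1 + 1 / c, fun v hv => ?_⟩
  rcases eq_or_ne v 0 with rfl | h0
  · simp; positivity
  have hn : 0 < ‖v‖ := norm_pos_iff.2 h0
  have h1 := hcB (‖v‖⁻¹ • v) (by rw [norm_smul, norm_inv, norm_norm]; field_simp)
  simp only [map_smul, FunLike.coe_smul, Pi.smul_apply, smul_eq_mul] at h1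
  have hv' : B v v < 1 := hv
  have h2 : c * ‖v‖ ^ 2 < 1 := by
    have : c * ‖v‖ ^ 2 ≤ B v v := by
      calc c * ‖v‖ ^ 2 ≤ (‖v‖⁻¹ * (‖v‖⁻¹ * B v v)) * ‖v‖ ^ 2 := by gcongr
        _ = B v v := by field_simp
    linarith
  have h3 : ‖v‖ ^ 2 < 1 / c := by rw [lt_div_iff₀ hc0]; linarith
  nlinarith [sq_nonneg (‖v‖ - 1)]

theorem contDiff_pullbackForm {F E' : Type*} [NormedAddCommGroup F] [NormedSpace ℝ F]
    [FiniteDimensional ℝ F] [NormedAddCommGroup E'] [NormedSpace ℝ E'] :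
    ContDiff ℝ ∞ fun q : (E' →L[ℝ] E' →L[ℝ] ℝ) × (F →L[ℝ] E') => pullbackForm q.1 q.2 := by
  rw [contDiff_clm_apply_iff]
  intro u
  rw [contDiff_clm_apply_iff]
  intro v
  simp only [pullbackForm_apply]
  have h (w : F) : ContDiff ℝ ∞ fun q : (E' →L[ℝ] E' →L[ℝ] ℝ) × (F →L[ℝ] E') => q.2 w :=
    contDiff_snd.clm_apply contDiff_const
  exact (contDiff_fst.clm_apply (h u)).clm_apply (h v)

/-- The sphere `S⁴ⁿ⁺³`, the unit sphere of `ℍⁿ⁺¹`. -/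
abbrev HopfSphere (n : ℕ) : Type := sphere (0 : QSpace n) 1

/-- The inclusion of a tangent space of the sphere in `ℍⁿ⁺¹`. -/
noncomputable def tangentInclusion (n : ℕ) (p : HopfSphere n) :
    TangentSpace (𝓡 (4 * n + 3)) p →L[ℝ] QSpace n :=
  mfderiv (𝓡 (4 * n + 3)) 𝓘(ℝ, QSpace n) ((↑) : HopfSphere n → QSpace n) p

theorem tangentInclusion_injective (n : ℕ) (p : HopfSphere n) :
    Function.Injective (tangentInclusion n p) := by
  convert! injective_mvfderiv_subtypeVal_sphere p

/-- The metric `g_(t₁,t₂,t₃)` on `S⁴ⁿ⁺³`: the round metric, with the metric on the Hopf fibres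
replaced by the left invariant one in which `p i, p j, p k` are orthogonal with length squared
`t₁, t₂, t₃`. -/
noncomputable def hopfMetric (n : ℕ) (t : Fin 3 → ℝ) (ht : ∀ i, 0 < t i) :
    ContMDiffRiemannianMetric (𝓡 (4 * n + 3)) ∞ (EuclideanSpace ℝ (Fin (4 * n + 3)))
      (fun p : HopfSphere n => TangentSpace (𝓡 (4 * n + 3)) p) where
  inner p := pullbackForm (ambientForm n t p) (tangentInclusion n p)
  symm p u v := by
    simp only [pullbackForm_apply, ambientForm_apply]
    rw [real_inner_comm]
    congr 1
    exact Finset.sum_congr rfl fun i _ => by ring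
  pos p u hu := by
    rw [pullbackForm_apply]
    refine ambientForm_pos n t ht p (norm_eq_of_mem_sphere p) _ fun h => hu ?_
    exact tangentInclusion_injective n p (h.trans (map_zero _).symm)
  isVonNBounded p := by
    refine isVonNBounded_of_pos (F := EuclideanSpace ℝ (Fin (4 * n + 3)))
      (pullbackForm (ambientForm n t p) (tangentInclusion n p)) fun u hu => ?_
    refine ambientForm_pos n t ht p (norm_eq_of_mem_sphere p) _ fun h => hu ?_
    exact tangentInclusion_injective n p (h.trans (map_zero _).symm)
  contMDiff := by
    intro p₀
    rw [contMDiffAt_section]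
    have h1 : ContMDiffAt (𝓡 (4 * n + 3)) 𝓘(ℝ, QSpace n →L[ℝ] QSpace n →L[ℝ] ℝ) ∞
        (fun p : HopfSphere n => ambientForm n t p) p₀ :=
      (ambientForm_contDiff n t).contMDiff.contMDiffAt.comp p₀ contMDiff_coe_sphere.contMDiffAt
    have h2 := ContMDiffAt.mfderiv_const (n := ∞) (m := ∞)
      (contMDiff_coe_sphere (E := QSpace n) (n := 4 * n + 3)).contMDiffAt (x₀ := p₀) le_rfl
    refine ((contDiff_pullbackForm.contMDiff.contMDiffAt.comp p₀
      (h1.prodMk_space h2))).congr_of_eventuallyEq ?_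
    have hb : (trivializationAt (EuclideanSpace ℝ (Fin (4 * n + 3)))
        (fun p : HopfSphere n => TangentSpace (𝓡 (4 * n + 3)) p) p₀).baseSet ∈ nhds p₀ :=
      (Trivialization.open_baseSet _).mem_nhds (mem_baseSet_trivializationAt _ _ _)
    filter_upwards [hb] with p hp
    ext u v
    rw [hom_trivializationAt_apply]
    refine (inCoordinates_apply_eq₂ hp hp (Set.mem_univ _)).trans ?_
    have key (w : EuclideanSpace ℝ (Fin (4 * n + 3))) :
        inTangentCoordinates (𝓡 (4 * n + 3)) 𝓘(ℝ, QSpace n) id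
          ((↑) : HopfSphere n → QSpace n) (fun p => tangentInclusion n p) p₀ p w =
        tangentInclusion n p ((trivializationAt (EuclideanSpace ℝ (Fin (4 * n + 3)))
          (fun p : HopfSphere n => TangentSpace (𝓡 (4 * n + 3)) p) p₀).symm p w) := by
      simp only [inTangentCoordinates, ContinuousLinearMap.inCoordinates,
        TangentBundle.continuousLinearMapAt_model_space]
      change tangentInclusion n p (Trivialization.symmL ℝ (trivializationAt
        (EuclideanSpace ℝ (Fin (4 * n + 3)))
        (fun p : HopfSphere n => TangentSpace (𝓡 (4 * n + 3)) p) p₀) p w) = _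
      rw [Trivialization.symmL_apply]
      exact hp
    simp only [Trivial.fiberBundle_trivializationAt', Trivial.linearMapAt_trivialization]
    change ambientForm n t p _ _ = ambientForm n t p _ _
    exact (congrArg₂ (fun a b => ambientForm n t p a b) (key u) (key v)).symm

/-- The quantity `Vᵢ`, with `(i, j, k) = (i, i + 1, i + 2)` cyclic. -/
noncomputable def verticalV (t : Fin 3 → ℝ) (i : Fin 3) : ℝ :=
  (t (i + 1) ^ 2 + t (i + 2) ^ 2 - 3 * t i ^ 2 + 2 * t i * t (i + 1) + 2 * t i * t (i + 2)
    - 2 * t (i + 1) * t (i + 2)) / t i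

/-- The quantity `Hᵢ`. -/
def horizontalH (t : Fin 3 → ℝ) (i : Fin 3) : ℝ := 4 - 3 * t i

/-! ### Curvature from second derivatives of the metric -/

section CurvatureFormula

variable {E : Type*} [NormedAddCommGroup E] [NormedSpace ℝ E]

/-! The proof computes the curvature numerator of a plane exactly, then settles when it is positive.
In the stereographic chart centred at `p` the metric is the round conformal metric plus `∑ (tᵢ - 1)
ωᵢ ⊗ ωᵢ`, with `ωᵢ` the connection forms of the Hopf fibration. Its 2-jet at the origin and the
quaternion relations give the numerator `hopfCurvature` (`riemannTensor_stereoMetric`). For `u = x +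
p a`, `v = y + p b` with `x`, `y` horizontal, put `c = a × b`, `θᵢ = ⟨x eᵢ, y⟩` and `Mᵢ = tⱼtₖ - tⱼ
- tₖ + tᵢ`. The numerator is `|x ∧ y|² + ∑ (3(1 - tᵢ)θᵢ² + Vᵢcᵢ² + 6Mᵢθᵢcᵢ + tᵢ²|bᵢx - aᵢy|²)`.

Two estimates decouple the three indices. Bessel's inequality gives `|x ∧ y|² ≥ ∑ θᵢ²`
(`sum_sq_inner_fibreField_le`), which turns `3(1 - tᵢ)` into `Hᵢ`. A determinant-trace inequality
gives `∑ tᵢ²|bᵢx - aᵢy|² ≥ 2 ∑ tⱼtₖ|cᵢθᵢ|` (`vertizontal_lower_bound`). What remains is, for each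
`i`, the function `Hᵢθᵢ² + Vᵢcᵢ² + 6Mᵢθᵢcᵢ + 2tⱼtₖ|θᵢcᵢ|`, and the stated inequalities make it
positive away from zero (`two_variable_pos`). The equality case then rules out a zero on a genuine
plane (`hopfCurvatureAt_pos`).

Conversely, both estimates are equalities on suitable planes spanned by `αx + a p eᵢ₊₁` and `βx eᵢ +
b p eᵢ₊₂`, so positivity there forces each inequality (`hopfPositivityCondition_of_pos`). -/

theorem fderiv_clm_apply_apply {G : E → E →L[ℝ] E →L[ℝ] ℝ} {y : E}
    (hG : DifferentiableAt ℝ G y) (a b c : E) :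
    fderiv ℝ (fun z => G z b c) y a = fderiv ℝ G y a b c := by
  have h1 : HasFDerivAt (fun z => G z b) _ y :=
    hG.hasFDerivAt.clm_apply (hasFDerivAt_const b y)
  have h2 := (h1.clm_apply (hasFDerivAt_const c y)).fderiv
  rw [h2]; simp

/-- The curvature `G (R(u, v) v, u)` in terms of second derivatives of `G` and of Christoffel
symbols. -/
theorem riemannTensor_inner_eq [FiniteDimensional ℝ E] {G : E → E →L[ℝ] E →L[ℝ] ℝ} {x : E}
    (hG : ContDiff ℝ ∞ G) (hs : ∀ y a b, G y a b = G y b a) (hx : (G x).IsInvertible) (u v : E) :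
    G x (riemannTensor G x u v v) u =
      fderiv ℝ (fun y => fderiv ℝ (fun z => G z v u) y v) x u
      - 1 / 2 * fderiv ℝ (fun y => fderiv ℝ (fun z => G z v v) y u) x u
      - 1 / 2 * fderiv ℝ (fun y => fderiv ℝ (fun z => G z u u) y v) x v
      + G x (christoffel G x u v) (christoffel G x u v)
      - G x (christoffel G x u u) (christoffel G x v v) := by
  have : CompleteSpace E := FiniteDimensional.complete ℝ E
  have hd : Differentiable ℝ G := hG.differentiable (by simp)
  have hsm (b c : E) : ContDiff ℝ ∞ fun z => G z b c :=
    (hG.clm_apply contDiff_const).clm_apply contDiff_const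
  have hsm' (a b c : E) : ContDiff ℝ ∞ fun y => fderiv ℝ (fun z => G z b c) y a :=
    ((hsm b c).fderiv_right (m := ∞) (by simp)).clm_apply contDiff_const
  have hDs (y a b c : E) : fderiv ℝ G y a b c = fderiv ℝ G y a c b := by
    rw [← fderiv_clm_apply_apply (hd y), ← fderiv_clm_apply_apply (hd y)]
    simp only [hs _ b c]
  -- the defining equation of the Christoffel symbols
  have hΓ (y : E) (hy : (G y).IsInvertible) (a b c : E) : G y (christoffel G y a b) c =
      1 / 2 * (fderiv ℝ G y a b c + fderiv ℝ G y b a c - fderiv ℝ G y c a b) := by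
    rw [christoffel, hy.self_apply_inverse]; simp
  -- The equation defining the Christoffel symbols is about to be differentiated, so it must hold
  -- near `x`; invertibility is an open condition.
  have hinv : ∀ᶠ y in nhds x, (G y).IsInvertible := by
    obtain ⟨e, he⟩ := hx
    have := hG.continuous.continuousAt (x := x) |>.preimage_mem_nhds
      (he ▸ ContinuousLinearEquiv.nhds e)
    filter_upwards [this] with y hy
    obtain ⟨e', he'⟩ := hy
    exact ⟨e', he'⟩
  have hdiff (a b : E) : DifferentiableAt ℝ (fun y => christoffel G y a b) x := by
    unfold christoffel
    refine DifferentiableAt.clm_apply ?_ ?_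
    · exact ((hx.contDiffAt_map_inverse (n := ∞)).comp x hG.contDiffAt).differentiableAt (by simp)
    · refine ContDiff.differentiable (n := ∞) ?_ (by simp) |>.differentiableAt
      rw [contDiff_clm_apply_iff]
      intro c
      have h : ContDiff ℝ ∞ fun y => 1 / 2 * (fderiv ℝ (fun z => G z b c) y a
          + fderiv ℝ (fun z => G z a c) y b - fderiv ℝ (fun z => G z a b) y c) :=
        contDiff_const.mul (((hsm' a b c).add (hsm' b a c)).sub (hsm' c a b))
      refine (congrArg (ContDiff ℝ ∞) (funext fun y => ?_)).mp h
      simp [fderiv_clm_apply_apply (hd y)]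
  -- Differentiating `G(Γ(a, b), c)` by the product rule expresses `G(∂Γ, c)` through second
  -- derivatives of `G`, without differentiating the inverse of `G`.
  have key (a b c d : E) :
      G x (fderiv ℝ (fun y => christoffel G y a b) x d) c
        + fderiv ℝ G x d (christoffel G x a b) c =
      1 / 2 * (fderiv ℝ (fun y => fderiv ℝ (fun z => G z b c) y a) x d
        + fderiv ℝ (fun y => fderiv ℝ (fun z => G z a c) y b) x d
        - fderiv ℝ (fun y => fderiv ℝ (fun z => G z a b) y c) x d) := by
    have h1 := (((hd x).hasFDerivAt.clm_apply (hdiff a b).hasFDerivAt).clm_apply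
      (hasFDerivAt_const c x))
    have hD (a b c : E) := ((hsm' a b c).differentiable (by simp) x).hasFDerivAt
    have h2 := (((hD a b c).add (hD b a c)).sub (hD c a b)).const_mul (1 / 2)
    have h3 := h1.congr_of_eventuallyEq (f₁ := fun y => 1 / 2 *
        (fderiv ℝ (fun z => G z b c) y a + fderiv ℝ (fun z => G z a c) y b
          - fderiv ℝ (fun z => G z a b) y c)) (by
      filter_upwards [hinv] with y hy
      simp only [fderiv_clm_apply_apply (hd y)]
      exact (hΓ y hy a b c).symm)
    have := congrArg (fun L => L d) (h3.unique h2)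
    simpa using this
  have hsymm (a b : E) : christoffel G x a b = christoffel G x b a := by
    have h : ∀ c, G x (christoffel G x a b) c = G x (christoffel G x b a) c := fun c => by
      rw [hΓ x hx, hΓ x hx, hDs x c a b]; ring
    exact hx.injective (ContinuousLinearMap.ext h)
  -- The choice of arguments makes the mixed second derivatives in `e2` cancel, so no symmetry of
  -- second derivatives is needed. The remaining first-derivative terms are rewritten through `Γ` by
  -- `e3`–`e6`.
  have e1 := key v v u u
  have e2 := key u v u v
  have e3 := hΓ x hx u (christoffel G x v v) u
  have e4 := hΓ x hx v (christoffel G x u v) u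
  have e5 := hΓ x hx u u (christoffel G x v v)
  have e6 := hΓ x hx u v (christoffel G x u v)
  simp only [riemannTensor, map_add, map_sub, add_apply,
    sub_apply]
  have s1 := hDs x u (christoffel G x v v) u
  have s2 := hDs x v (christoffel G x u v) u
  have s3 := hDs x (christoffel G x u v) u v
  have s4 := hDs x u (christoffel G x u v) v
  simp only [hs _ u v] at e2 ⊢
  linarith

end CurvatureFormula

/-! ### Calculus of 2-jets at the origin -/

section SecondOrderJets

variable {E : Type*} [NormedAddCommGroup E] [NormedSpace ℝ E]

/-- A smooth function with value `c`, differential `L` and second differential `Q` at `0`. -/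
structure HasJet (f : E → ℝ) (c : ℝ) (L : E → ℝ) (Q : E → E → ℝ) : Prop where
  contDiff : ContDiff ℝ ∞ f
  value : f 0 = c
  first (a : E) : fderiv ℝ f 0 a = L a
  second (a b : E) : fderiv ℝ (fun y => fderiv ℝ f y b) 0 a = Q a b

namespace HasJet

variable {f g : E → ℝ} {c d : ℝ} {L M : E → ℝ} {Q R : E → E → ℝ}

theorem differentiable (h : HasJet f c L Q) : Differentiable ℝ f :=
  h.contDiff.differentiable (by simp)

theorem contDiff_fderiv (h : HasJet f c L Q) (b : E) : ContDiff ℝ ∞ fun y => fderiv ℝ f y b :=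
  (h.contDiff.fderiv_right (m := ∞) (by simp)).clm_apply contDiff_const

theorem differentiable_fderiv (h : HasJet f c L Q) (b : E) :
    Differentiable ℝ fun y => fderiv ℝ f y b :=
  (h.contDiff_fderiv b).differentiable (by simp)

theorem const (c : ℝ) : HasJet (fun _ : E => c) c (fun _ => 0) fun _ _ => 0 where
  contDiff := contDiff_const
  value := rfl
  first a := by simp
  second a b := by simp

theorem clm (l : E →L[ℝ] ℝ) : HasJet (fun x => l x) 0 (fun a => l a) fun _ _ => 0 where
  contDiff := l.contDiff
  value := by simp
  first a := by simp
  second a b := by simp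

theorem add (hf : HasJet f c L Q) (hg : HasJet g d M R) :
    HasJet (fun x => f x + g x) (c + d) (fun a => L a + M a) fun a b => Q a b + R a b where
  contDiff := hf.contDiff.add hg.contDiff
  value := by rw [hf.value, hg.value]
  first a := by
    rw [fderiv_fun_add (hf.differentiable 0) (hg.differentiable 0), ← hf.first, ← hg.first]; rfl
  second a b := by
    have : (fun y => fderiv ℝ (fun x => f x + g x) y b) =
        fun y => fderiv ℝ f y b + fderiv ℝ g y b := by
      ext y; rw [fderiv_fun_add (hf.differentiable y) (hg.differentiable y)]; rfl
    rw [this, fderiv_fun_add (hf.differentiable_fderiv b 0) (hg.differentiable_fderiv b 0),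
      ← hf.second, ← hg.second]; rfl

theorem mul (hf : HasJet f c L Q) (hg : HasJet g d M R) :
    HasJet (fun x => f x * g x) (c * d) (fun a => c * M a + d * L a)
      fun a b => c * R a b + L a * M b + (d * Q a b + M a * L b) where
  contDiff := hf.contDiff.mul hg.contDiff
  value := by rw [hf.value, hg.value]
  first a := by
    rw [fderiv_fun_mul (hf.differentiable 0) (hg.differentiable 0), ← hf.first, ← hg.first,
      ← hf.value, ← hg.value]; rfl
  second a b := by
    have : (fun y => fderiv ℝ (fun x => f x * g x) y b) =
        fun y => f y * fderiv ℝ g y b + g y * fderiv ℝ f y b := by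
      ext y; rw [fderiv_fun_mul (hf.differentiable y) (hg.differentiable y)]; rfl
    rw [this, fderiv_fun_add
      ((hf.differentiable 0).fun_mul (hg.differentiable_fderiv b 0))
      ((hg.differentiable 0).fun_mul (hf.differentiable_fderiv b 0)),
      fderiv_fun_mul (hf.differentiable 0) (hg.differentiable_fderiv b 0),
      fderiv_fun_mul (hg.differentiable 0) (hf.differentiable_fderiv b 0)]
    simp only [FunLike.coe_add, FunLike.coe_smul, Pi.add_apply, Pi.smul_apply, smul_eq_mul,
      hf.first, hg.first, hf.second, hg.second, hf.value, hg.value]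
    ring

theorem inv (hf : HasJet f c L Q) (h0 : ∀ x, f x ≠ 0) :
    HasJet (fun x => (f x)⁻¹) c⁻¹ (fun a => -(c⁻¹ ^ 2 * L a))
      fun a b => 2 * c⁻¹ ^ 3 * (L a * L b) - c⁻¹ ^ 2 * Q a b := by
  have hd (y : E) : HasFDerivAt (fun x => (f x)⁻¹) (-((f y)⁻¹ ^ 2) • fderiv ℝ f y) y := by
    have := (hasDerivAt_inv (h0 y)).comp_hasFDerivAt y (hf.differentiable y).hasFDerivAt
    simpa [Function.comp_def, inv_pow] using this
  refine ⟨hf.contDiff.inv h0, by rw [hf.value], fun a => ?_, fun a b => ?_⟩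
  · rw [(hd 0).fderiv, ← hf.first, ← hf.value]; simp
  · have : (fun y => fderiv ℝ (fun x => (f x)⁻¹) y b) =
        fun y => -((f y)⁻¹ * ((f y)⁻¹ * fderiv ℝ f y b)) := by
      ext y; rw [(hd y).fderiv]; simp; ring
    rw [this]
    have h1 := (hd 0).mul ((hd 0).mul (hf.differentiable_fderiv b 0).hasFDerivAt)
    have h2 := h1.neg.fderiv
    rw [show (fun y => -((f y)⁻¹ * ((f y)⁻¹ * fderiv ℝ f y b))) =
      -((fun y => (f y)⁻¹) * ((fun y => (f y)⁻¹) * fun y => fderiv ℝ f y b)) from rfl, h2]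
    simp only [FunLike.coe_add, FunLike.coe_neg, FunLike.coe_smul, Pi.neg_apply, Pi.add_apply,
      Pi.smul_apply, Pi.mul_apply, smul_eq_mul, hf.first, hf.second, hf.value]
    ring

theorem sum {ι : Type*} (s : Finset ι) {f : ι → E → ℝ} {c : ι → ℝ} {L : ι → E → ℝ}
    {Q : ι → E → E → ℝ} (h : ∀ i, HasJet (f i) (c i) (L i) (Q i)) :
    HasJet (fun x => ∑ i ∈ s, f i x) (∑ i ∈ s, c i) (fun a => ∑ i ∈ s, L i a)
      fun a b => ∑ i ∈ s, Q i a b := by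
  classical
  induction s using Finset.induction_on with
  | empty => simpa using const 0
  | insert i s hi ih => simpa only [Finset.sum_insert hi] using (h i).add ih

theorem congr (hf : HasJet f c L Q) (h : ∀ x, g x = f x) (hc : c = d) (hL : ∀ a, L a = M a)
    (hQ : ∀ a b, Q a b = R a b) : HasJet g d M R := by
  obtain rfl : g = f := funext h
  obtain rfl : L = M := funext hL
  obtain rfl : Q = R := funext₂ hQ
  exact hc ▸ hf

end HasJet

end SecondOrderJets

theorem hasJet_norm_sq {E : Type*} [NormedAddCommGroup E] [InnerProductSpace ℝ E] :
    HasJet (fun x : E => ‖x‖ ^ 2) 0 (fun _ => 0) fun a b => 2 * ⟪a, b⟫_ℝ where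
  contDiff := contDiff_norm_sq ℝ
  value := by simp
  first a := by rw [(hasStrictFDerivAt_norm_sq (0 : E)).hasFDerivAt.fderiv]; simp
  second a b := by
    have : (fun y : E => fderiv ℝ (fun x : E => ‖x‖ ^ 2) y b) = fun y => (2 • innerSL ℝ b) y := by
      ext y; rw [(hasStrictFDerivAt_norm_sq y).hasFDerivAt.fderiv]; simp [real_inner_comm]
    rw [this, ContinuousLinearMap.fderiv]; simp [real_inner_comm]

/-! ### Inner products of vectors multiplied by imaginary units -/

section QuaternionTable

variable {n : ℕ}

theorem inner_fibreField_left (i : Fin 3) (z w : QSpace n) :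
    ⟪fibreField n i z, w⟫_ℝ = -⟪fibreField n i w, z⟫_ℝ := by
  have key (q r : ℍ[ℝ]) : ⟪q * imUnit i, r⟫_ℝ = -⟪r * imUnit i, q⟫_ℝ := by
    rw [Quaternion.inner_def, Quaternion.inner_def]
    simp only [Quaternion.re_mul, Quaternion.imI_mul, Quaternion.imJ_mul,
      Quaternion.imK_mul, Quaternion.re_star, Quaternion.imI_star, Quaternion.imJ_star,
      Quaternion.imK_star]
    have h : (imUnit i).re = 0 := by fin_cases i <;> rfl
    rw [h]
    ring
  rw [QSpace.inner_def, QSpace.inner_def, ← Finset.sum_neg_distrib]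
  exact Finset.sum_congr rfl fun s _ => key _ _

theorem inner_fibreField_self (i : Fin 3) (z : QSpace n) : ⟪fibreField n i z, z⟫_ℝ = 0 := by
  have := inner_fibreField_left i z z
  linarith

theorem inner_fibreField_fibreField (i : Fin 3) (z w : QSpace n) :
    ⟪fibreField n i z, fibreField n i w⟫_ℝ = ⟪z, w⟫_ℝ := by
  have key (q r : ℍ[ℝ]) : ⟪q * imUnit i, r * imUnit i⟫_ℝ = ⟪q, r⟫_ℝ := by
    fin_cases i <;>
      simp only [imUnit, Quaternion.inner_def, Quaternion.re_mul, Quaternion.imI_mul,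
        Quaternion.imJ_mul, Quaternion.imK_mul, Quaternion.re_star, Quaternion.imI_star,
        Quaternion.imJ_star, Quaternion.imK_star] <;> simp <;> ring
  rw [QSpace.inner_def, QSpace.inner_def]
  simp only [fibreField_apply, key]

/-- Right multiplication by `eᵢ₊₁` is skew, and `eᵢ eᵢ₊₁ = eᵢ₊₂` with indices mod 3. -/
theorem inner_fibreField_succ (i : Fin 3) (z w : QSpace n) :
    ⟪fibreField n i z, fibreField n (i + 1) w⟫_ℝ = -⟪fibreField n (i + 2) z, w⟫_ℝ := by
  have key (q r : ℍ[ℝ]) : ⟪q * imUnit i, r * imUnit (i + 1)⟫_ℝ = -⟪q * imUnit (i + 2), r⟫_ℝ := by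
    fin_cases i <;>
      simp only [imUnit, Quaternion.inner_def, Quaternion.re_mul, Quaternion.imI_mul,
        Quaternion.imJ_mul, Quaternion.imK_mul, Quaternion.re_star, Quaternion.imI_star,
        Quaternion.imJ_star, Quaternion.imK_star] <;> simp <;> ring
  rw [QSpace.inner_def, QSpace.inner_def, ← Finset.sum_neg_distrib]
  simp only [fibreField_apply, key]

theorem inner_fibreField_succ_left (i : Fin 3) (z w : QSpace n) :
    ⟪fibreField n (i + 1) z, fibreField n i w⟫_ℝ = ⟪fibreField n (i + 2) z, w⟫_ℝ := by
  rw [real_inner_comm, inner_fibreField_succ, inner_fibreField_left, neg_neg]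

end QuaternionTable

/-- The numerator of the sectional curvature of the plane spanned by `p a + x` and `p b + y` with
`x`, `y` horizontal, `X = ⟨x, x⟩`, `Y = ⟨y, y⟩`, `Z = ⟨x, y⟩` and `θᵢ = ⟨x eᵢ, y⟩`. -/
noncomputable def hopfCurvature (t a b θ : Fin 3 → ℝ) (X Y Z : ℝ) : ℝ :=
  X * Y - Z ^ 2 + ∑ i, (3 * (1 - t i) * θ i ^ 2
    + verticalV t i * (a (i + 1) * b (i + 2) - a (i + 2) * b (i + 1)) ^ 2
    + t i ^ 2 * (b i ^ 2 * X - 2 * (a i * b i) * Z + a i ^ 2 * Y)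
    + 6 * (t (i + 1) * t (i + 2) - t (i + 1) - t (i + 2) + t i) * θ i
      * (a (i + 1) * b (i + 2) - a (i + 2) * b (i + 1)))

/-! ### Christoffel symbols and the curvature identity at a point -/

section ChristoffelVector

variable {n : ℕ}

/-- The vector whose inner products are the Christoffel symbols of the first kind at `p`. -/
noncomputable def christoffelCovector (n : ℕ) (t : Fin 3 → ℝ) (p u v : QSpace n) : QSpace n :=
  ∑ i, (t i - 1) • (⟪fibreField n i p, v⟫_ℝ • fibreField n i u
    + ⟪fibreField n i p, u⟫_ℝ • fibreField n i v)

/-- The tangent vector at `p` dual to `y` with respect to `ambientForm n t p`. -/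
noncomputable def raiseIndex (n : ℕ) (t : Fin 3 → ℝ) (p y : QSpace n) : QSpace n :=
  y - ⟪p, y⟫_ℝ • p + ∑ i, ((t i)⁻¹ - 1) • (⟪fibreField n i p, y⟫_ℝ • fibreField n i p)

theorem inner_raiseIndex (t : Fin 3 → ℝ) (p y : QSpace n) (hp : ‖p‖ = 1) :
    ⟪p, raiseIndex n t p y⟫_ℝ = 0 := by
  have h (i : Fin 3) : ⟪p, fibreField n i p⟫_ℝ = 0 := by
    rw [real_inner_comm]; exact inner_fibreField_self i p
  simp [raiseIndex, inner_add_right, inner_sub_right, inner_sum, inner_smul_right, h, hp]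

/-- The form multiplies the fibre direction `p eᵢ` by `tᵢ` and fixes horizontal vectors, so its
inverse divides by `tᵢ`. Dropping the component along `p` is harmless against `w ⊥ p`. -/
theorem ambientForm_raiseIndex (t : Fin 3 → ℝ) (ht : ∀ i, t i ≠ 0) (p y w : QSpace n)
    (hp : ‖p‖ = 1) (hw : ⟪p, w⟫_ℝ = 0) :
    ambientForm n t p (raiseIndex n t p y) w = ⟪y, w⟫_ℝ := by
  have hξ (i : Fin 3) : ⟪fibreField n i p, raiseIndex n t p y⟫_ℝ =
      (t i)⁻¹ * ⟪fibreField n i p, y⟫_ℝ := by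
    simp only [raiseIndex, inner_add_right, inner_sub_right, inner_sum, inner_smul_right,
      inner_fibreField, inner_fibreField_self, hp]
    simp; ring
  rw [ambientForm_apply]
  simp only [hξ]
  simp only [raiseIndex, inner_add_left, inner_sub_left, sum_inner, inner_smul_left, hw]
  simp only [Fin.sum_univ_three, RCLike.conj_to_real]
  have h (i : Fin 3) : (t i - 1) * (t i)⁻¹ = 1 - (t i)⁻¹ := by
    rw [sub_mul, mul_inv_cancel₀ (ht i), one_mul]
  linear_combination ⟪fibreField n 0 p, y⟫_ℝ * ⟪fibreField n 0 p, w⟫_ℝ * h 0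
    + ⟪fibreField n 1 p, y⟫_ℝ * ⟪fibreField n 1 p, w⟫_ℝ * h 1
    + ⟪fibreField n 2 p, y⟫_ℝ * ⟪fibreField n 2 p, w⟫_ℝ * h 2

/-- The left side is the formula of `riemannTensor_inner_eq` with the jets of the metric inserted.
The quaternion table reduces every inner product to `a`, `b`, `T` and those of `u`, `v`, leaving a
rational identity in `t`; the denominators of `Vᵢ` come from raising the index. The shift of `T` by
`a × b` passes from `⟨u eᵢ, v⟩` to the same product of the horizontal parts. -/
theorem hopfCurvature_identity (t : Fin 3 → ℝ) (ht : ∀ i, t i ≠ 0) (p u v : QSpace n)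
    (hu : ⟪p, u⟫_ℝ = 0) (hv : ⟪p, v⟫_ℝ = 0) (a b T : Fin 3 → ℝ)
    (ha : ∀ i, ⟪fibreField n i p, u⟫_ℝ = a i) (hb : ∀ i, ⟪fibreField n i p, v⟫_ℝ = b i)
    (hT : ∀ i, ⟪fibreField n i u, v⟫_ℝ = T i) :
    (-⟪u, v⟫_ℝ ^ 2 + ∑ i, (t i - 1) * (⟪u, u⟫_ℝ * b i ^ 2 / 2 + ⟪v, v⟫_ℝ * a i ^ 2 / 2
        - 2 * ⟪u, v⟫_ℝ * a i * b i - T i ^ 2))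
      - 1 / 2 * (-⟪u, u⟫_ℝ * ⟪v, v⟫_ℝ + ∑ i, (t i - 1) *
        (2 * b i * (⟪u, v⟫_ℝ * a i - 3 / 2 * ⟪u, u⟫_ℝ * b i) + 2 * T i ^ 2))
      - 1 / 2 * (-⟪u, u⟫_ℝ * ⟪v, v⟫_ℝ + ∑ i, (t i - 1) *
        (2 * a i * (⟪u, v⟫_ℝ * b i - 3 / 2 * ⟪v, v⟫_ℝ * a i) + 2 * T i ^ 2))
      + ⟪christoffelCovector n t p u v, raiseIndex n t p (christoffelCovector n t p u v)⟫_ℝ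
      - ⟪christoffelCovector n t p u u, raiseIndex n t p (christoffelCovector n t p v v)⟫_ℝ =
    hopfCurvature t a b (fun i => T i + (a (i + 1) * b (i + 2) - a (i + 2) * b (i + 1)))
      (⟪u, u⟫_ℝ - ∑ i, a i ^ 2) (⟪v, v⟫_ℝ - ∑ i, b i ^ 2) (⟪u, v⟫_ℝ - ∑ i, a i * b i) := by
  have h01 (z w : QSpace n) : ⟪fibreField n 0 z, fibreField n 1 w⟫_ℝ = -⟪fibreField n 2 z, w⟫_ℝ :=
    inner_fibreField_succ 0 z w
  have h12 (z w : QSpace n) : ⟪fibreField n 1 z, fibreField n 2 w⟫_ℝ = -⟪fibreField n 0 z, w⟫_ℝ :=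
    inner_fibreField_succ 1 z w
  have h20 (z w : QSpace n) : ⟪fibreField n 2 z, fibreField n 0 w⟫_ℝ = -⟪fibreField n 1 z, w⟫_ℝ :=
    inner_fibreField_succ 2 z w
  have h10 (z w : QSpace n) : ⟪fibreField n 1 z, fibreField n 0 w⟫_ℝ = ⟪fibreField n 2 z, w⟫_ℝ :=
    inner_fibreField_succ_left 0 z w
  have h21 (z w : QSpace n) : ⟪fibreField n 2 z, fibreField n 1 w⟫_ℝ = ⟪fibreField n 0 z, w⟫_ℝ :=
    inner_fibreField_succ_left 1 z w
  have h02 (z w : QSpace n) : ⟪fibreField n 0 z, fibreField n 2 w⟫_ℝ = ⟪fibreField n 1 z, w⟫_ℝ :=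
    inner_fibreField_succ_left 2 z w
  have hpu (i : Fin 3) : ⟪p, fibreField n i u⟫_ℝ = -a i := by
    rw [real_inner_comm, inner_fibreField_left, ha]
  have hpv (i : Fin 3) : ⟪p, fibreField n i v⟫_ℝ = -b i := by
    rw [real_inner_comm, inner_fibreField_left, hb]
  have hup (i : Fin 3) : ⟪fibreField n i u, p⟫_ℝ = -a i := by rw [inner_fibreField_left, ha]
  have hvp (i : Fin 3) : ⟪fibreField n i v, p⟫_ℝ = -b i := by rw [inner_fibreField_left, hb]
  have hvu (i : Fin 3) : ⟪fibreField n i v, u⟫_ℝ = -T i := by rw [inner_fibreField_left, hT]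
  have i1 : (1 : Fin 3) + 1 = 2 := rfl
  have i2 : (1 : Fin 3) + 2 = 0 := rfl
  have i3 : (2 : Fin 3) + 1 = 0 := rfl
  have i4 : (2 : Fin 3) + 2 = 1 := rfl
  simp only [christoffelCovector, raiseIndex, hopfCurvature, verticalV, Fin.sum_univ_three,
    zero_add, i1, i2, i3, i4, ha, hb]
  simp only [inner_add_left, inner_add_right, inner_sub_right, real_inner_smul_left,
    real_inner_smul_right, h01, h12, h20, h10, h21, h02, hpu, hpv, hup, hvp, hvu, hT, ha, hb,
    inner_fibreField_fibreField, inner_fibreField_self, hu, hv,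
    show ⟪u, p⟫_ℝ = 0 by rw [real_inner_comm, hu], show ⟪v, p⟫_ℝ = 0 by rw [real_inner_comm, hv],
    real_inner_comm u v]
  generalize ⟪u, u⟫_ℝ = X
  generalize ⟪v, v⟫_ℝ = Y
  generalize ⟪u, v⟫_ℝ = Z
  have h0 := ht 0
  have h1 := ht 1
  have h2 := ht 2
  generalize t 0 = t0 at *
  generalize t 1 = t1 at *
  generalize t 2 = t2 at *
  field_simp
  ring

end ChristoffelVector

/-! ### The metric in stereographic coordinates -/

section StereographicParametrization

variable {n : ℕ} {E : Type*} [NormedAddCommGroup E] [InnerProductSpace ℝ E]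

/-- The inverse of the stereographic projection from `-p`, in coordinates given by an isometry `ι`
onto the orthogonal complement of `p`. -/
noncomputable def stereoParam (ι : E →ₗᵢ[ℝ] QSpace n) (p : QSpace n) (x : E) : QSpace n :=
  (‖x‖ ^ 2 + 4)⁻¹ • ((4 : ℝ) • ι x + (8 : ℝ) • p) - p

theorem contDiff_stereoParam (ι : E →ₗᵢ[ℝ] QSpace n) (p : QSpace n) :
    ContDiff ℝ ∞ (stereoParam ι p) := by
  have h : ContDiff ℝ ∞ fun x : E => (‖x‖ ^ 2 + 4)⁻¹ := by
    have h1 : ContDiff ℝ ∞ fun x : E => ‖x‖ ^ 2 + 4 := (contDiff_norm_sq ℝ).add contDiff_const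
    exact h1.inv fun x => by positivity
  have h2 : ContDiff ℝ ∞ fun x : E => (4 : ℝ) • ι x + (8 : ℝ) • p :=
    ((4 : ℝ) • ι.toContinuousLinearMap).contDiff.add contDiff_const
  have h3 : ContDiff ℝ ∞ fun x : E => (‖x‖ ^ 2 + 4)⁻¹ • ((4 : ℝ) • ι x + (8 : ℝ) • p) :=
    h.smul h2
  exact h3.sub contDiff_const

theorem fderiv_stereoParam (ι : E →ₗᵢ[ℝ] QSpace n) (p : QSpace n) (x u : E) :
    fderiv ℝ (stereoParam ι p) x u = (4 * (‖x‖ ^ 2 + 4)⁻¹) • ι u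
      - (2 * (‖x‖ ^ 2 + 4)⁻¹ ^ 2 * ⟪x, u⟫_ℝ) • ((4 : ℝ) • ι x + (8 : ℝ) • p) := by
  have h0 : ‖x‖ ^ 2 + 4 ≠ 0 := by positivity
  have h1 : HasFDerivAt (fun x : E => ‖x‖ ^ 2 + 4) (2 • innerSL ℝ x) x :=
    (hasStrictFDerivAt_norm_sq x).hasFDerivAt.add_const 4
  have h2 := (hasDerivAt_inv h0).comp_hasFDerivAt x h1
  have h3 : HasFDerivAt (fun x : E => (4 : ℝ) • ι x + (8 : ℝ) • p)
      ((4 : ℝ) • ι.toContinuousLinearMap) x :=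
    (ι.toContinuousLinearMap.hasFDerivAt.const_smul (4 : ℝ)).add_const _
  have h4 := ((h2.smul h3).sub_const p).fderiv
  have h5 : stereoParam ι p = fun y => ((fun y : ℝ => y⁻¹) ∘ fun x : E => ‖x‖ ^ 2 + 4) y •
    ((4 : ℝ) • ι y + (8 : ℝ) • p) - p := rfl
  rw [h5]
  refine (congrArg (fun L => L u) h4).trans ?_
  simp [smul_smul]
  module

/-- The values of the pulled back connection forms `u ↦ ⟨q eᵢ, u⟩` of the Hopf fibration. -/
noncomputable def connectionForm (ι : E →ₗᵢ[ℝ] QSpace n) (p : QSpace n) (i : Fin 3) (x u : E) : ℝ :=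
  (‖x‖ ^ 2 + 4)⁻¹ ^ 2 * (16 * ⟪fibreField n i (ι x), ι u⟫_ℝ + 32 * ⟪fibreField n i p, ι u⟫_ℝ
    + 8 * (⟪x, u⟫_ℝ * ⟪fibreField n i p, ι x⟫_ℝ))
    - 4 * ⟪fibreField n i p, ι u⟫_ℝ * (‖x‖ ^ 2 + 4)⁻¹

theorem inner_fibreField_stereoParam (ι : E →ₗᵢ[ℝ] QSpace n) (p : QSpace n) (i : Fin 3) (x u : E) :
    ⟪fibreField n i (stereoParam ι p x), fderiv ℝ (stereoParam ι p) x u⟫_ℝ =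
      connectionForm ι p i x u := by
  rw [fderiv_stereoParam, stereoParam, connectionForm]
  simp only [map_sub, map_add, map_smul, inner_sub_left, inner_sub_right, inner_add_left,
    inner_add_right, real_inner_smul_left, real_inner_smul_right, inner_fibreField_self,
    inner_fibreField_left i (ι x) p]
  ring

/-- Conformality of stereographic projection: the rank-one terms cancel because `|4ιx + 8p|² =
16(|x|² + 4)`, as `ιx ⊥ p`. -/
theorem inner_fderiv_stereoParam (ι : E →ₗᵢ[ℝ] QSpace n) (p : QSpace n) (hp : ‖p‖ = 1)
    (hι : ∀ x, ⟪p, ι x⟫_ℝ = 0) (x u v : E) :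
    ⟪fderiv ℝ (stereoParam ι p) x u, fderiv ℝ (stereoParam ι p) x v⟫_ℝ =
      16 * (‖x‖ ^ 2 + 4)⁻¹ ^ 2 * ⟪u, v⟫_ℝ := by
  have hι' (x : E) : ⟪ι x, p⟫_ℝ = 0 := by rw [real_inner_comm, hι]
  have hr : (‖x‖ ^ 2 + 4)⁻¹ * (‖x‖ ^ 2 + 4) = 1 := inv_mul_cancel₀ (by positivity)
  rw [fderiv_stereoParam, fderiv_stereoParam]
  simp only [inner_sub_left, inner_sub_right, inner_add_left, inner_add_right,
    real_inner_smul_left, real_inner_smul_right, hι, hι', LinearIsometry.inner_map_map,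
    real_inner_self_eq_norm_sq, hp, real_inner_comm x u]
  linear_combination 64 * (‖x‖ ^ 2 + 4)⁻¹ ^ 3 * ⟪x, u⟫_ℝ * ⟪x, v⟫_ℝ * hr

/-- The metric read in the stereographic chart. -/
noncomputable def stereoMetric (t : Fin 3 → ℝ) (ι : E →ₗᵢ[ℝ] QSpace n) (p : QSpace n) (x : E) :
    E →L[ℝ] E →L[ℝ] ℝ :=
  pullbackForm (ambientForm n t (stereoParam ι p x)) (fderiv ℝ (stereoParam ι p) x)

theorem stereoMetric_apply (t : Fin 3 → ℝ) (ι : E →ₗᵢ[ℝ] QSpace n) (p : QSpace n) (hp : ‖p‖ = 1)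
    (hι : ∀ x, ⟪p, ι x⟫_ℝ = 0) (x u v : E) :
    stereoMetric t ι p x u v = 16 * (‖x‖ ^ 2 + 4)⁻¹ ^ 2 * ⟪u, v⟫_ℝ
      + ∑ i, (t i - 1) * (connectionForm ι p i x u * connectionForm ι p i x v) := by
  simp only [stereoMetric, pullbackForm_apply, ambientForm_apply, inner_fibreField_stereoParam,
    inner_fderiv_stereoParam ι p hp hι]

/-- The parametrization is normalized to send `0` to `p` with differential `ι`. -/
theorem stereoMetric_zero (t : Fin 3 → ℝ) (ι : E →ₗᵢ[ℝ] QSpace n) (p : QSpace n) (u v : E) :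
    stereoMetric t ι p 0 u v = ambientForm n t p (ι u) (ι v) := by
  have h0 : stereoParam ι p 0 = p := by
    simp only [stereoParam, norm_zero, map_zero]; module
  have h1 (u : E) : fderiv ℝ (stereoParam ι p) 0 u = ι u := by
    rw [fderiv_stereoParam]; simp
  rw [stereoMetric, pullbackForm_apply, h0, h1, h1]

theorem contDiff_stereoMetric [FiniteDimensional ℝ E] (t : Fin 3 → ℝ) (ι : E →ₗᵢ[ℝ] QSpace n)
    (p : QSpace n) : ContDiff ℝ ∞ (stereoMetric t ι p) :=
  contDiff_pullbackForm.comp (((ambientForm_contDiff n t).comp (contDiff_stereoParam ι p)).prodMk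
    ((contDiff_stereoParam ι p).fderiv_right (m := ∞) (by simp)))

theorem hasJet_inv_norm_sq_add_four :
    HasJet (fun x : E => (‖x‖ ^ 2 + 4)⁻¹) (1 / 4) (fun _ => 0) fun a b => -⟪a, b⟫_ℝ / 8 :=
  ((hasJet_norm_sq.add (HasJet.const 4)).inv fun x => by positivity).congr (fun _ => rfl)
    (by norm_num) (fun a => by norm_num) fun a b => by norm_num; ring

/-- The first derivative is skew in `a` and `u`: at the origin it is half the exterior derivative of
the connection form. The second derivative carries only the conformal correction. -/
theorem hasJet_connectionForm (ι : E →ₗᵢ[ℝ] QSpace n) (p : QSpace n) (i : Fin 3) (u : E) :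
    HasJet (fun x => connectionForm ι p i x u) ⟪fibreField n i p, ι u⟫_ℝ
      (fun a => ⟪fibreField n i (ι a), ι u⟫_ℝ)
      fun a b => 1 / 2 * (⟪a, u⟫_ℝ * ⟪fibreField n i p, ι b⟫_ℝ
        + ⟪b, u⟫_ℝ * ⟪fibreField n i p, ι a⟫_ℝ)
        - 3 / 2 * ⟪a, b⟫_ℝ * ⟪fibreField n i p, ι u⟫_ℝ := by
  have hω : HasJet (fun x => ⟪fibreField n i (ι x), ι u⟫_ℝ) 0
      (fun a => ⟪fibreField n i (ι a), ι u⟫_ℝ) fun _ _ => 0 :=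
    (HasJet.clm ((innerSL ℝ (ι u)).comp ((fibreField n i).comp ι.toContinuousLinearMap))).congr
      (fun x => by simp [real_inner_comm]) rfl (fun x => by simp [real_inner_comm]) fun _ _ => rfl
  have hη : HasJet (fun x => ⟪fibreField n i p, ι x⟫_ℝ) 0
      (fun a => ⟪fibreField n i p, ι a⟫_ℝ) fun _ _ => 0 :=
    HasJet.clm ((innerSL ℝ (fibreField n i p)).comp ι.toContinuousLinearMap)
  have hu : HasJet (fun x => ⟪x, u⟫_ℝ) 0 (fun a => ⟪a, u⟫_ℝ) fun _ _ => 0 :=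
    (HasJet.clm (innerSL ℝ u)).congr (fun x => by simp [real_inner_comm]) rfl
      (fun x => by simp [real_inner_comm]) fun _ _ => rfl
  have hr := hasJet_inv_norm_sq_add_four (E := E)
  refine ((hr.mul hr).mul ((((HasJet.const 16).mul hω).add
    (HasJet.const (32 * ⟪fibreField n i p, ι u⟫_ℝ))).add
    ((HasJet.const 8).mul (hu.mul hη))) |>.add
    ((HasJet.const (-4 * ⟪fibreField n i p, ι u⟫_ℝ)).mul hr)).congr ?_ ?_ ?_ ?_
  · intro x; rw [connectionForm]; ring
  · ring
  · intro a; ring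
  · intro a b; ring

theorem hasJet_stereoMetric (t : Fin 3 → ℝ) (ι : E →ₗᵢ[ℝ] QSpace n) (p : QSpace n) (hp : ‖p‖ = 1)
    (hι : ∀ x, ⟪p, ι x⟫_ℝ = 0) (u v : E) :
    HasJet (fun x => stereoMetric t ι p x u v)
      (⟪u, v⟫_ℝ + ∑ i, (t i - 1) * (⟪fibreField n i p, ι u⟫_ℝ * ⟪fibreField n i p, ι v⟫_ℝ))
      (fun a => ∑ i, (t i - 1) * (⟪fibreField n i p, ι u⟫_ℝ * ⟪fibreField n i (ι a), ι v⟫_ℝ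
        + ⟪fibreField n i p, ι v⟫_ℝ * ⟪fibreField n i (ι a), ι u⟫_ℝ))
      fun a b => -⟪a, b⟫_ℝ * ⟪u, v⟫_ℝ + ∑ i, (t i - 1) *
        (⟪fibreField n i p, ι u⟫_ℝ * (1 / 2 * (⟪a, v⟫_ℝ * ⟪fibreField n i p, ι b⟫_ℝ
            + ⟪b, v⟫_ℝ * ⟪fibreField n i p, ι a⟫_ℝ)
          - 3 / 2 * ⟪a, b⟫_ℝ * ⟪fibreField n i p, ι v⟫_ℝ)
        + ⟪fibreField n i p, ι v⟫_ℝ * (1 / 2 * (⟪a, u⟫_ℝ * ⟪fibreField n i p, ι b⟫_ℝ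
            + ⟪b, u⟫_ℝ * ⟪fibreField n i p, ι a⟫_ℝ)
          - 3 / 2 * ⟪a, b⟫_ℝ * ⟪fibreField n i p, ι u⟫_ℝ)
        + ⟪fibreField n i (ι a), ι u⟫_ℝ * ⟪fibreField n i (ι b), ι v⟫_ℝ
        + ⟪fibreField n i (ι a), ι v⟫_ℝ * ⟪fibreField n i (ι b), ι u⟫_ℝ) := by
  have hr := hasJet_inv_norm_sq_add_four (E := E)
  refine (((HasJet.const (16 * ⟪u, v⟫_ℝ)).mul (hr.mul hr)).add (HasJet.sum Finset.univ fun i =>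
    (HasJet.const (t i - 1)).mul ((hasJet_connectionForm ι p i u).mul
      (hasJet_connectionForm ι p i v)))).congr ?_ ?_ ?_ ?_
  · intro x; rw [stereoMetric_apply t ι p hp hι]; ring
  · ring
  · intro a; simp only [Fin.sum_univ_three]; ring
  · intro a b; simp only [Fin.sum_univ_three]; ring

theorem isInvertible_of_pos [FiniteDimensional ℝ E] (B : E →L[ℝ] E →L[ℝ] ℝ)
    (hB : ∀ u, u ≠ 0 → 0 < B u u) : B.IsInvertible := by
  have hinj : Function.Injective (B : E →ₗ[ℝ] E →L[ℝ] ℝ) := by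
    rw [← LinearMap.ker_eq_bot, LinearMap.ker_eq_bot']
    intro u hu
    by_contra h
    have := hB u h
    have h0 : B u = 0 := hu
    simp [h0] at this
  have hdim : finrank ℝ E = finrank ℝ (E →L[ℝ] ℝ) := by
    rw [← (LinearMap.toContinuousLinearMap (𝕜 := ℝ) (E := E) (F' := ℝ)).finrank_eq]
    exact (Subspace.dual_finrank_eq (K := ℝ) (V := E)).symm
  refine ⟨(LinearEquiv.ofInjectiveOfFinrankEq _ hinj hdim).toContinuousLinearEquiv, ?_⟩
  ext u v; rfl

/-- The conformal factor is stationary at the origin, so only the terms with `tᵢ - 1` contribute.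
Skewness of the first derivatives of `ωᵢ` collapses the Koszul combination to `christoffelCovector`.
-/
theorem christoffel_stereoMetric [FiniteDimensional ℝ E] (t : Fin 3 → ℝ) (ht : ∀ i, 0 < t i)
    (ι : E →ₗᵢ[ℝ] QSpace n) (p : QSpace n) (hp : ‖p‖ = 1) (hι : ∀ x, ⟪p, ι x⟫_ℝ = 0)
    (hι' : ∀ w, ⟪p, w⟫_ℝ = 0 → ∃ x, ι x = w) (hinv : (stereoMetric t ι p 0).IsInvertible)
    (u v : E) :
    ι (christoffel (stereoMetric t ι p) 0 u v) =
      raiseIndex n t p (christoffelCovector n t p (ι u) (ι v)) := by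
  obtain ⟨γ, hγ⟩ := hι' _ (inner_raiseIndex t p (christoffelCovector n t p (ι u) (ι v)) hp)
  rw [← hγ]
  congr 1
  have hd : DifferentiableAt ℝ (stereoMetric t ι p) 0 :=
    (contDiff_stereoMetric t ι p).differentiable (by simp) 0
  have h (a b c : E) : fderiv ℝ (stereoMetric t ι p) 0 a b c =
      ∑ i, (t i - 1) * (⟪fibreField n i p, ι b⟫_ℝ * ⟪fibreField n i (ι a), ι c⟫_ℝ
        + ⟪fibreField n i p, ι c⟫_ℝ * ⟪fibreField n i (ι a), ι b⟫_ℝ) := by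
    rw [← fderiv_clm_apply_apply hd]
    exact (hasJet_stereoMetric t ι p hp hι b c).first a
  rw [christoffel, hinv.inverse_apply_eq]
  ext w
  rw [stereoMetric_zero, hγ, ambientForm_raiseIndex t (fun i => (ht i).ne') p _ _ hp (hι w)]
  simp only [FunLike.coe_smul, Pi.smul_apply, FunLike.coe_sub, Pi.sub_apply, FunLike.coe_add,
    Pi.add_apply, ContinuousLinearMap.flip_apply, h, christoffelCovector,
    real_inner_smul_left, inner_add_left, smul_eq_mul, Fin.sum_univ_three]
  simp only [inner_fibreField_left _ (ι v) (ι u), inner_fibreField_left _ (ι w) (ι u),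
    inner_fibreField_left _ (ι w) (ι v)]
  ring

theorem riemannTensor_stereoMetric [FiniteDimensional ℝ E] (t : Fin 3 → ℝ) (ht : ∀ i, 0 < t i)
    (ι : E →ₗᵢ[ℝ] QSpace n) (p : QSpace n) (hp : ‖p‖ = 1) (hι : ∀ x, ⟪p, ι x⟫_ℝ = 0)
    (hι' : ∀ w, ⟪p, w⟫_ℝ = 0 → ∃ x, ι x = w) (u v : E) (a b T : Fin 3 → ℝ)
    (ha : ∀ i, ⟪fibreField n i p, ι u⟫_ℝ = a i) (hb : ∀ i, ⟪fibreField n i p, ι v⟫_ℝ = b i)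
    (hT : ∀ i, ⟪fibreField n i (ι u), ι v⟫_ℝ = T i) :
    stereoMetric t ι p 0 (riemannTensor (stereoMetric t ι p) 0 u v v) u =
      hopfCurvature t a b (fun i => T i + (a (i + 1) * b (i + 2) - a (i + 2) * b (i + 1)))
        (⟪ι u, ι u⟫_ℝ - ∑ i, a i ^ 2) (⟪ι v, ι v⟫_ℝ - ∑ i, b i ^ 2)
        (⟪ι u, ι v⟫_ℝ - ∑ i, a i * b i) := by
  have hinv : (stereoMetric t ι p 0).IsInvertible := by
    refine isInvertible_of_pos _ fun u hu => ?_
    rw [stereoMetric_zero]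
    exact ambientForm_pos n t ht p hp _ ((map_ne_zero_iff ι ι.injective).2 hu)
  have hs (y a b : E) : stereoMetric t ι p y a b = stereoMetric t ι p y b a := by
    rw [stereoMetric_apply t ι p hp hι, stereoMetric_apply t ι p hp hι, real_inner_comm]
    simp only [mul_comm]
  have hΓ (u v u' v' : E) :
      stereoMetric t ι p 0 (christoffel (stereoMetric t ι p) 0 u v)
        (christoffel (stereoMetric t ι p) 0 u' v') =
      ⟪christoffelCovector n t p (ι u) (ι v),
        raiseIndex n t p (christoffelCovector n t p (ι u') (ι v'))⟫_ℝ := by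
    rw [stereoMetric_zero, christoffel_stereoMetric t ht ι p hp hι hι' hinv,
      christoffel_stereoMetric t ht ι p hp hι hι' hinv,
      ambientForm_raiseIndex t (fun i => (ht i).ne') p _ _ hp (inner_raiseIndex t p _ hp)]
  rw [riemannTensor_inner_eq (contDiff_stereoMetric t ι p) hs hinv, hΓ, hΓ,
    (hasJet_stereoMetric t ι p hp hι v u).second, (hasJet_stereoMetric t ι p hp hι v v).second,
    (hasJet_stereoMetric t ι p hp hι u u).second,
    ← hopfCurvature_identity t (fun i => (ht i).ne') p (ι u) (ι v) (hι u) (hι v) a b T ha hb hT]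
  have hvu (i : Fin 3) : ⟪fibreField n i (ι v), ι u⟫_ℝ = -T i := by
    rw [inner_fibreField_left, hT]
  simp only [ha, hb, hT, hvu, inner_fibreField_self, LinearIsometry.inner_map_map,
    real_inner_comm u v, Fin.sum_univ_three]
  ring

end StereographicParametrization

/-! ### Algebraic lower bounds for the numerator -/

section AlgebraicPositivity

/-- For positive semidefinite `2 × 2` matrices, `4 det M det N ≤ tr(M adj N)²`. -/
theorem four_mul_det_mul_det_le {A B C X Y Z : ℝ} (hX : 0 ≤ X) (hZ : Z ^ 2 ≤ X * Y) :
    4 * ((A * B - C ^ 2) * (X * Y - Z ^ 2)) ≤ (A * X - 2 * C * Z + B * Y) ^ 2 := by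
  rcases hX.eq_or_lt with rfl | hX
  · have : Z = 0 := by nlinarith [sq_nonneg Z]
    subst this
    nlinarith [sq_nonneg (B * Y)]
  -- After multiplication by `X²` the difference is a square plus `4(XY - Z²)` times a square; no
  -- sign condition on `A`, `B`, `C` enters.
  · have h : 0 ≤ X ^ 2 * ((A * X - 2 * C * Z + B * Y) ^ 2
        - 4 * ((A * B - C ^ 2) * (X * Y - Z ^ 2))) := by
      have h1 : 0 ≤ 4 * (X * Y - Z ^ 2) * (C * X - B * Z) ^ 2 :=
        mul_nonneg (by linarith) (sq_nonneg _)
      have h2 := sq_nonneg (X ^ 2 * A - B * X * Y - 2 * C * Z * X + 2 * B * Z ^ 2)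
      linarith [show X ^ 2 * ((A * X - 2 * C * Z + B * Y) ^ 2
        - 4 * ((A * B - C ^ 2) * (X * Y - Z ^ 2))) =
        (X ^ 2 * A - B * X * Y - 2 * C * Z * X + 2 * B * Z ^ 2) ^ 2
          + 4 * (X * Y - Z ^ 2) * (C * X - B * Z) ^ 2 by ring]
    have := nonneg_of_mul_nonneg_right h (by positivity)
    linarith

/-- The right side is `tr(M adj N)` for the Gram matrix `N` of `x`, `y` and the Gram matrix `M` of
the vectors `(tᵢbᵢ)`, `(tᵢaᵢ)`. By Lagrange's identity `det M = ∑ (tⱼtₖcᵢ)²`, and `∑ θᵢ² ≤ det N`.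
Cauchy–Schwarz bounds the left side by `2√(det M det N)`, and the trace dominates this. -/
theorem vertizontal_lower_bound (t a b θ : Fin 3 → ℝ) {X Y Z : ℝ} (hX : 0 ≤ X)
    (hB : ∑ i, θ i ^ 2 + Z ^ 2 ≤ X * Y)
    (hnn : ∀ i, 0 ≤ b i ^ 2 * X - 2 * (a i * b i) * Z + a i ^ 2 * Y) :
    2 * ∑ i, t (i + 1) * t (i + 2) * |a (i + 1) * b (i + 2) - a (i + 2) * b (i + 1)| * |θ i| ≤
      ∑ i, t i ^ 2 * (b i ^ 2 * X - 2 * (a i * b i) * Z + a i ^ 2 * Y) := by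
  have hθ : 0 ≤ ∑ i, θ i ^ 2 := Finset.sum_nonneg fun i _ => sq_nonneg _
  set A := ∑ i, t i ^ 2 * b i ^ 2 with hA
  set B := ∑ i, t i ^ 2 * a i ^ 2 with hBd
  set C := ∑ i, t i ^ 2 * (a i * b i) with hC
  have hR : ∑ i, t i ^ 2 * (b i ^ 2 * X - 2 * (a i * b i) * Z + a i ^ 2 * Y) =
      A * X - 2 * C * Z + B * Y := by
    simp only [hA, hBd, hC, Fin.sum_univ_three]; ring
  have hR0 : 0 ≤ A * X - 2 * C * Z + B * Y := by
    rw [← hR]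
    exact Finset.sum_nonneg fun i _ => mul_nonneg (sq_nonneg _) (hnn i)
  have hCS := Finset.sum_mul_sq_le_sq_mul_sq Finset.univ
    (fun i => t (i + 1) * t (i + 2) * |a (i + 1) * b (i + 2) - a (i + 2) * b (i + 1)|)
    fun i => |θ i|
  have hL : ∑ i, (t (i + 1) * t (i + 2) *
      |a (i + 1) * b (i + 2) - a (i + 2) * b (i + 1)|) ^ 2 = A * B - C ^ 2 := by
    simp only [mul_pow, sq_abs, hA, hBd, hC, Fin.sum_univ_three, zero_add,
      show (1 : Fin 3) + 1 = 2 from rfl, show (1 : Fin 3) + 2 = 0 from rfl,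
      show (2 : Fin 3) + 1 = 0 from rfl, show (2 : Fin 3) + 2 = 1 from rfl]
    ring
  have hD : 0 ≤ A * B - C ^ 2 := hL ▸ Finset.sum_nonneg fun i _ => sq_nonneg _
  rw [hL] at hCS
  simp only [sq_abs] at hCS
  rw [hR]
  refine (abs_le_of_sq_le_sq' ?_ hR0).2
  have h4 := four_mul_det_mul_det_le (A := A) (B := B) (C := C) hX (Z := Z) (Y := Y) (by linarith)
  have h5 : (A * B - C ^ 2) * ∑ i, θ i ^ 2 ≤ (A * B - C ^ 2) * (X * Y - Z ^ 2) :=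
    mul_le_mul_of_nonneg_left (by linarith) hD
  rw [mul_pow]
  linarith

/-- Completing the square as `(√H|x| - √V|y|)²` leaves at least `2(T + √(HV) - 3|M|)|xy|`. -/
theorem two_variable_pos {H V T M x y : ℝ} (hH : 0 < H) (hV : 0 < V)
    (hM : 3 * |M| < T + √(H * V)) (hxy : x ≠ 0 ∨ y ≠ 0) :
    0 < H * x ^ 2 + V * y ^ 2 + 6 * M * x * y + 2 * T * |y| * |x| := by
  have h1 : -(|M| * |x| * |y|) ≤ M * x * y := by
    rw [← abs_mul, ← abs_mul]; exact neg_abs_le _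
  rw [Real.sqrt_mul hH.le] at hM
  have h2 := Real.sq_sqrt hH.le
  have h3 := Real.sq_sqrt hV.le
  have h4 : H * x ^ 2 + V * y ^ 2 = (√H * |x| - √V * |y|) ^ 2 + 2 * (√H * √V) * (|x| * |y|) := by
    rw [sub_sq, mul_pow, mul_pow, sq_abs, sq_abs, h2, h3]; ring
  rcases eq_or_ne x 0 with rfl | hx
  · have hy : y ≠ 0 := by simpa using hxy
    have := mul_pos hV (pow_pos (abs_pos.2 hy) 2)
    simp only [sq_abs] at this
    simpa using this
  rcases eq_or_ne y 0 with rfl | hy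
  · have := mul_pos hH (pow_pos (abs_pos.2 hx) 2)
    simp only [sq_abs] at this
    simpa using this
  have h5 : 0 < (T + √H * √V - 3 * |M|) * (|x| * |y|) :=
    mul_pos (by linarith) (mul_pos (abs_pos.2 hx) (abs_pos.2 hy))
  nlinarith [sq_nonneg (√H * |x| - √V * |y|)]

theorem two_variable_nonneg {H V T M x y : ℝ} (hH : 0 < H) (hV : 0 < V)
    (hM : 3 * |M| < T + √(H * V)) :
    0 ≤ H * x ^ 2 + V * y ^ 2 + 6 * M * x * y + 2 * T * |y| * |x| := by
  by_cases h : x ≠ 0 ∨ y ≠ 0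
  · exact (two_variable_pos hH hV hM h).le
  · push Not at h
    simp [h.1, h.2]

/-- The condition on `t` characterizing positive curvature. -/
def HopfPositivityCondition (t : Fin 3 → ℝ) : Prop :=
  ∀ i : Fin 3, 0 < verticalV t i ∧ 0 < horizontalH t i ∧
    3 * |t (i + 1) * t (i + 2) - t (i + 1) - t (i + 2) + t i| <
      t (i + 1) * t (i + 2) + √(horizontalH t i * verticalV t i)

/-- The numerator is a sum of three nonnegative pieces: the Bessel defect, the two-variable
functions and the defect in `vertizontal_lower_bound`. If it is not positive, all three vanish.
Linear independence is not visible in these data, so the equality case is recorded instead of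
positivity. -/
theorem eq_zero_of_hopfCurvature_nonpos {t a b θ : Fin 3 → ℝ} {X Y Z : ℝ} (ht : ∀ i, 0 < t i)
    (hc : HopfPositivityCondition t) (hX : 0 ≤ X) (hB : ∑ i, θ i ^ 2 + Z ^ 2 ≤ X * Y)
    (hnn : ∀ i, 0 ≤ b i ^ 2 * X - 2 * (a i * b i) * Z + a i ^ 2 * Y)
    (hle : hopfCurvature t a b θ X Y Z ≤ 0) :
    (∀ i, a (i + 1) * b (i + 2) - a (i + 2) * b (i + 1) = 0) ∧ X * Y - Z ^ 2 = 0 ∧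
      ∀ i, b i ^ 2 * X - 2 * (a i * b i) * Z + a i ^ 2 * Y = 0 := by
  have hvz := vertizontal_lower_bound t a b θ hX hB hnn
  set c : Fin 3 → ℝ := fun i => a (i + 1) * b (i + 2) - a (i + 2) * b (i + 1) with hcd
  set S : Fin 3 → ℝ := fun i => horizontalH t i * θ i ^ 2 + verticalV t i * c i ^ 2
    + 6 * (t (i + 1) * t (i + 2) - t (i + 1) - t (i + 2) + t i) * θ i * c i
    + 2 * (t (i + 1) * t (i + 2)) * |c i| * |θ i| with hS
  have hS0 (i : Fin 3) (_ : i ∈ Finset.univ) : 0 ≤ S i :=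
    two_variable_nonneg (hc i).2.1 (hc i).1 (hc i).2.2
  -- Borrowing `∑ θᵢ²` from `XY - Z²` turns `3(1 - tᵢ)` into `Hᵢ = 4 - 3tᵢ`.
  have hsum : hopfCurvature t a b θ X Y Z = (X * Y - Z ^ 2 - ∑ i, θ i ^ 2) + ∑ i, S i +
      (∑ i, t i ^ 2 * (b i ^ 2 * X - 2 * (a i * b i) * Z + a i ^ 2 * Y)
        - 2 * ∑ i, t (i + 1) * t (i + 2) * |c i| * |θ i|) := by
    simp only [hopfCurvature, hS, hcd, horizontalH, Finset.sum_add_distrib, Fin.sum_univ_three]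
    ring
  have hS1 : ∑ i, S i = 0 := le_antisymm (by linarith) (Finset.sum_nonneg hS0)
  have hz (i : Fin 3) : θ i = 0 ∧ c i = 0 := by
    have h := (Finset.sum_eq_zero_iff_of_nonneg hS0).1 hS1 i (Finset.mem_univ i)
    by_contra hne
    exact (two_variable_pos (hc i).2.1 (hc i).1 (hc i).2.2 (not_and_or.1 hne)).ne' h
  have hcz (i : Fin 3) : c i = 0 := (hz i).2
  have hp0 (i : Fin 3) (_ : i ∈ Finset.univ) :
      0 ≤ t i ^ 2 * (b i ^ 2 * X - 2 * (a i * b i) * Z + a i ^ 2 * Y) :=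
    mul_nonneg (sq_nonneg _) (hnn i)
  simp only [hz, abs_zero, mul_zero, Finset.sum_const_zero, sub_zero, ne_eq, OfNat.ofNat_ne_zero,
    not_false_eq_true, zero_pow, zero_add] at hsum hB
  have h1 : ∑ i, t i ^ 2 * (b i ^ 2 * X - 2 * (a i * b i) * Z + a i ^ 2 * Y) = 0 :=
    le_antisymm (by linarith) (Finset.sum_nonneg hp0)
  refine ⟨hcz, by linarith, fun i => ?_⟩
  have h := (Finset.sum_eq_zero_iff_of_nonneg hp0).1 h1 i (Finset.mem_univ i)
  exact (mul_eq_zero.1 h).resolve_left (pow_pos (ht i) 2).ne'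

end AlgebraicPositivity

/-! ### Positivity on all tangent planes -/

section TangentPlanes

variable {n : ℕ}

/-- The numerator of the sectional curvature of the plane spanned by tangent vectors `u`, `v`
at `p`. -/
noncomputable def hopfCurvatureAt (n : ℕ) (t : Fin 3 → ℝ) (p u v : QSpace n) : ℝ :=
  hopfCurvature t (fun i => ⟪fibreField n i p, u⟫_ℝ) (fun i => ⟪fibreField n i p, v⟫_ℝ)
    (fun i => ⟪fibreField n i u, v⟫_ℝ
      + (⟪fibreField n (i + 1) p, u⟫_ℝ * ⟪fibreField n (i + 2) p, v⟫_ℝ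
        - ⟪fibreField n (i + 2) p, u⟫_ℝ * ⟪fibreField n (i + 1) p, v⟫_ℝ))
    (⟪u, u⟫_ℝ - ∑ i, ⟪fibreField n i p, u⟫_ℝ ^ 2) (⟪v, v⟫_ℝ - ∑ i, ⟪fibreField n i p, v⟫_ℝ ^ 2)
    (⟪u, v⟫_ℝ - ∑ i, ⟪fibreField n i p, u⟫_ℝ * ⟪fibreField n i p, v⟫_ℝ)

/-- The fibre components contribute `-(a × b)ᵢ` to `⟨u eᵢ, v⟩`, which the correction in
`hopfCurvatureAt` cancels; mixed terms vanish because horizontal vectors stay horizontal under right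
multiplication. -/
theorem hopfCurvatureAt_add (t : Fin 3 → ℝ) (p x y : QSpace n) (hp : ‖p‖ = 1)
    (hx : ∀ i, ⟪fibreField n i p, x⟫_ℝ = 0) (hy : ∀ i, ⟪fibreField n i p, y⟫_ℝ = 0)
    (hpx : ⟪p, x⟫_ℝ = 0) (hpy : ⟪p, y⟫_ℝ = 0) (a b : Fin 3 → ℝ) :
    hopfCurvatureAt n t p (x + ∑ i, a i • fibreField n i p) (y + ∑ i, b i • fibreField n i p) =
      hopfCurvature t a b (fun i => ⟪fibreField n i x, y⟫_ℝ) ⟪x, x⟫_ℝ ⟪y, y⟫_ℝ ⟪x, y⟫_ℝ := by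
  have hx' (i : Fin 3) : ⟪x, fibreField n i p⟫_ℝ = 0 := by rw [real_inner_comm, hx]
  have hy' (i : Fin 3) : ⟪y, fibreField n i p⟫_ℝ = 0 := by rw [real_inner_comm, hy]
  have ha (i : Fin 3) : ⟪fibreField n i p, x + ∑ j, a j • fibreField n j p⟫_ℝ = a i := by
    simp [inner_add_right, inner_sum, real_inner_smul_right, hx, inner_fibreField, hp]
  have hb (i : Fin 3) : ⟪fibreField n i p, y + ∑ j, b j • fibreField n j p⟫_ℝ = b i := by
    simp [inner_add_right, inner_sum, real_inner_smul_right, hy, inner_fibreField, hp]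
  have h01 (z w : QSpace n) : ⟪fibreField n 0 z, fibreField n 1 w⟫_ℝ = -⟪fibreField n 2 z, w⟫_ℝ :=
    inner_fibreField_succ 0 z w
  have h12 (z w : QSpace n) : ⟪fibreField n 1 z, fibreField n 2 w⟫_ℝ = -⟪fibreField n 0 z, w⟫_ℝ :=
    inner_fibreField_succ 1 z w
  have h20 (z w : QSpace n) : ⟪fibreField n 2 z, fibreField n 0 w⟫_ℝ = -⟪fibreField n 1 z, w⟫_ℝ :=
    inner_fibreField_succ 2 z w
  have h10 (z w : QSpace n) : ⟪fibreField n 1 z, fibreField n 0 w⟫_ℝ = ⟪fibreField n 2 z, w⟫_ℝ :=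
    inner_fibreField_succ_left 0 z w
  have h21 (z w : QSpace n) : ⟪fibreField n 2 z, fibreField n 1 w⟫_ℝ = ⟪fibreField n 0 z, w⟫_ℝ :=
    inner_fibreField_succ_left 1 z w
  have h02 (z w : QSpace n) : ⟪fibreField n 0 z, fibreField n 2 w⟫_ℝ = ⟪fibreField n 1 z, w⟫_ℝ :=
    inner_fibreField_succ_left 2 z w
  have hzero {z : QSpace n} (hz : ∀ i, ⟪fibreField n i p, z⟫_ℝ = 0) (hpz : ⟪p, z⟫_ℝ = 0)
      (i j : Fin 3) : ⟪fibreField n i z, fibreField n j p⟫_ℝ = 0 := by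
    have hz' (k : Fin 3) : ⟪fibreField n k z, p⟫_ℝ = 0 := by
      rw [inner_fibreField_left, hz, neg_zero]
    have hz0 : ⟪z, p⟫_ℝ = 0 := by rw [real_inner_comm, hpz]
    fin_cases i <;> fin_cases j <;>
      simp [h01, h12, h20, h10, h21, h02, inner_fibreField_fibreField, hz', hz0]
  have hyp (i j : Fin 3) : ⟪fibreField n i (fibreField n j p), y⟫_ℝ = 0 := by
    rw [inner_fibreField_left, hzero hy hpy, neg_zero]
  have hpp (i j : Fin 3) : ⟪fibreField n i (fibreField n j p), p⟫_ℝ = if i = j then -1 else 0 := by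
    rw [inner_fibreField_left, inner_fibreField, hp]; split_ifs <;> simp
  unfold hopfCurvatureAt
  simp only [ha, hb]
  congr 1
  · funext i
    simp only [Fin.sum_univ_three, map_add, map_smul, inner_add_left, inner_add_right,
      real_inner_smul_left, real_inner_smul_right, hzero hx hpx, hyp]
    fin_cases i <;>
      simp [h01, h12, h20, h10, h21, h02, inner_fibreField_fibreField, hpp,
        inner_fibreField_self] <;> ring
  · simp only [Fin.sum_univ_three, inner_add_left, inner_add_right, real_inner_smul_left,
      real_inner_smul_right, inner_fibreField, hp, hx, hx']
    simp; ring
  · simp only [Fin.sum_univ_three, inner_add_left, inner_add_right, real_inner_smul_left,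
      real_inner_smul_right, inner_fibreField, hp, hy, hy']
    simp; ring
  · simp only [Fin.sum_univ_three, inner_add_left, inner_add_right, real_inner_smul_left,
      real_inner_smul_right, inner_fibreField, hp, hx', hy]
    simp; ring

theorem exists_horizontal_add (p u : QSpace n) (hp : ‖p‖ = 1) (hu : ⟪p, u⟫_ℝ = 0) :
    ∃ (a : Fin 3 → ℝ) (x : QSpace n), u = x + ∑ i, a i • fibreField n i p ∧
      (∀ i, ⟪fibreField n i p, x⟫_ℝ = 0) ∧ ⟪p, x⟫_ℝ = 0 := by
  refine ⟨fun i => ⟪fibreField n i p, u⟫_ℝ, u - ∑ i, ⟪fibreField n i p, u⟫_ℝ • fibreField n i p,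
    by abel, fun i => ?_, ?_⟩
  · simp [inner_sub_right, inner_sum, real_inner_smul_right, inner_fibreField, hp]
  · have h (i : Fin 3) : ⟪p, fibreField n i p⟫_ℝ = 0 := by
      rw [real_inner_comm, inner_fibreField_self]
    simp [inner_sub_right, inner_sum, real_inner_smul_right, h, hu]

/-- Bessel's inequality for `y` against `x, x e₁, x e₂, x e₃`, which are orthogonal of equal length.
-/
theorem sum_sq_inner_fibreField_le (x y : QSpace n) :
    ∑ i, ⟪fibreField n i x, y⟫_ℝ ^ 2 + ⟪x, y⟫_ℝ ^ 2 ≤ ⟪x, x⟫_ℝ * ⟪y, y⟫_ℝ := by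
  rcases eq_or_ne x 0 with rfl | hx
  · simp
  have hX : 0 < ⟪x, x⟫_ℝ := real_inner_self_pos.2 hx
  have hxx (i : Fin 3) : ⟪x, fibreField n i x⟫_ℝ = 0 := by
    rw [real_inner_comm, inner_fibreField_self]
  -- The residual of `y` is scaled by `⟨x, x⟩` to avoid division; its squared norm is `⟨x, x⟩` times
  -- the Bessel defect.
  have h : 0 ≤ ⟪⟪x, x⟫_ℝ • y - ⟪x, y⟫_ℝ • x - ∑ i, ⟪fibreField n i x, y⟫_ℝ • fibreField n i x,
      ⟪x, x⟫_ℝ • y - ⟪x, y⟫_ℝ • x - ∑ i, ⟪fibreField n i x, y⟫_ℝ • fibreField n i x⟫_ℝ :=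
    real_inner_self_nonneg
  simp only [Fin.sum_univ_three, inner_sub_left, inner_sub_right, inner_add_left, inner_add_right,
    real_inner_smul_left, real_inner_smul_right, inner_fibreField_self, hxx, inner_fibreField,
    ← real_inner_self_eq_norm_sq, real_inner_comm x y,
    fun i : Fin 3 => real_inner_comm (fibreField n i x) y] at h
  simp only [Fin.isValue, ↓reduceIte, Fin.reduceEq] at h
  rw [Fin.sum_univ_three]
  refine le_of_mul_le_mul_left ?_ hX
  linarith

theorem hopfCurvatureAt_pos (t : Fin 3 → ℝ) (ht : ∀ i, 0 < t i) (hc : HopfPositivityCondition t)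
    (p u v : QSpace n) (hp : ‖p‖ = 1) (hu : ⟪p, u⟫_ℝ = 0) (hv : ⟪p, v⟫_ℝ = 0)
    (huv : LinearIndependent ℝ ![u, v]) : 0 < hopfCurvatureAt n t p u v := by
  rw [LinearIndependent.pair_iff] at huv
  obtain ⟨a, x, rfl, hx, hpx⟩ := exists_horizontal_add p u hp hu
  obtain ⟨b, y, rfl, hy, hpy⟩ := exists_horizontal_add p v hp hv
  rw [hopfCurvatureAt_add t p x y hp hx hy hpx hpy]
  by_contra hle
  have hsq (i : Fin 3) : b i ^ 2 * ⟪x, x⟫_ℝ - 2 * (a i * b i) * ⟪x, y⟫_ℝ + a i ^ 2 * ⟪y, y⟫_ℝ =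
      ⟪b i • x - a i • y, b i • x - a i • y⟫_ℝ := by
    simp only [inner_sub_left, inner_sub_right, real_inner_smul_left, real_inner_smul_right,
      real_inner_comm x y]
    ring
  obtain ⟨h1, h2, h3⟩ := eq_zero_of_hopfCurvature_nonpos ht hc real_inner_self_nonneg
    (sum_sq_inner_fibreField_le x y) (fun i => by rw [hsq]; exact real_inner_self_nonneg)
    (not_lt.1 hle)
  have h4 (i : Fin 3) : b i • x - a i • y = 0 := by
    rw [← inner_self_eq_zero (𝕜 := ℝ), ← hsq, h3]
  have h5 (i j : Fin 3) : b i * a j = a i * b j := by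
    have e0 := h1 0
    have e1 := h1 1
    have e2 := h1 2
    simp only [zero_add, show (1 : Fin 3) + 1 = 2 from rfl, show (1 : Fin 3) + 2 = 0 from rfl,
      show (2 : Fin 3) + 1 = 0 from rfl, show (2 : Fin 3) + 2 = 1 from rfl] at e0 e1 e2
    fin_cases i <;> fin_cases j <;> simp only [Fin.zero_eta, Fin.mk_one, Fin.reduceFinMk] <;>
      linarith
  -- Since `bᵢx = aᵢy` and `a × b = 0`, the combination `bᵢu - aᵢv` vanishes, so independence kills
  -- its coefficients. The plane is then horizontal, and equality in Cauchy–Schwarz makes `x`, `y`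
  -- dependent.
  have h6 (i : Fin 3) : b i = 0 ∧ a i = 0 := by
    have := huv (b i) (-a i) (by
      have h7 : ∑ j, (b i * a j) • fibreField n j p = ∑ j, (a i * b j) • fibreField n j p :=
        Finset.sum_congr rfl fun j _ => by rw [h5]
      simp only [smul_add, Finset.smul_sum, smul_smul, neg_mul, neg_smul, Finset.sum_neg_distrib,
        h7]
      rw [← h4 i]; abel)
    exact ⟨this.1, neg_eq_zero.1 this.2⟩
  simp only [h6, zero_smul, Finset.sum_const_zero, add_zero] at huv
  have h7 : ⟪y, y⟫_ℝ • x - ⟪x, y⟫_ℝ • y = 0 := by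
    rw [← inner_self_eq_zero (𝕜 := ℝ)]
    simp only [inner_sub_left, inner_sub_right, real_inner_smul_left, real_inner_smul_right,
      real_inner_comm x y]
    linear_combination ⟪y, y⟫_ℝ * h2
  have h8 := (huv ⟪y, y⟫_ℝ (-⟪x, y⟫_ℝ) (by rw [neg_smul, ← sub_eq_add_neg, h7])).1
  rw [inner_self_eq_zero] at h8
  exact one_ne_zero (huv 0 1 (by simp [h8])).2

end TangentPlanes

/-! ### Test planes and necessity -/

section TestPlanes

variable {n : ℕ}

/-- A unit vector of a coordinate line. -/
noncomputable def coordVector (n : ℕ) (s : Fin (n + 1)) : QSpace n :=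
  WithLp.toLp 2 (Pi.single s 1)

theorem norm_coordVector (s : Fin (n + 1)) : ‖coordVector n s‖ = 1 := by
  have h : ⟪coordVector n s, coordVector n s⟫_ℝ = 1 := by
    rw [QSpace.inner_def, Finset.sum_eq_single s]
    · simp [coordVector]
    · intro r _ hr; simp [coordVector, hr]
    · simp
  rw [real_inner_self_eq_norm_sq] at h
  nlinarith [norm_nonneg (coordVector n s)]

theorem inner_coordVector_of_ne {s r : Fin (n + 1)} (h : s ≠ r) :
    ⟪coordVector n s, coordVector n r⟫_ℝ = 0 := by
  rw [QSpace.inner_def]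
  refine Finset.sum_eq_zero fun l _ => ?_
  rcases eq_or_ne l s with rfl | hl
  · simp [coordVector, h]
  · simp [coordVector, hl]

theorem inner_fibreField_coordVector_of_ne (i : Fin 3) {s r : Fin (n + 1)} (h : s ≠ r) :
    ⟪fibreField n i (coordVector n s), coordVector n r⟫_ℝ = 0 := by
  rw [QSpace.inner_def]
  refine Finset.sum_eq_zero fun l _ => ?_
  rw [fibreField_apply]
  rcases eq_or_ne l s with rfl | hl
  · simp [coordVector, h]
  · simp [coordVector, hl]

/-- Here `θ` and `a × b` are supported at the single index `i`, and `XY - Z² = θᵢ²`: Bessel's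
inequality is sharp because the second horizontal part is a multiple of `x eᵢ`. -/
theorem hopfCurvature_testPlane (t : Fin 3 → ℝ) (i : Fin 3) (α β a b : ℝ) :
    hopfCurvature t (Pi.single (i + 1) a) (Pi.single (i + 2) b) (Pi.single i (α * β))
      (α ^ 2) (β ^ 2) 0 =
    horizontalH t i * (α * β) ^ 2 + verticalV t i * (a * b) ^ 2 + t (i + 1) ^ 2 * (a * β) ^ 2
      + t (i + 2) ^ 2 * (b * α) ^ 2
      + 6 * (t (i + 1) * t (i + 2) - t (i + 1) - t (i + 2) + t i) * (α * β) * (a * b) := by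
  simp only [hopfCurvature, Fin.sum_univ_three, horizontalH]
  fin_cases i <;> simp <;> ring

/-- The planes spanned by `α x + a p eᵢ₊₁` and `β x eᵢ + b p eᵢ₊₂` for a horizontal unit
vector `x`. -/
theorem testPlane_pos (hn : 1 ≤ n) (t : Fin 3 → ℝ)
    (h : ∀ p u v : QSpace n, ‖p‖ = 1 → ⟪p, u⟫_ℝ = 0 → ⟪p, v⟫_ℝ = 0 →
      LinearIndependent ℝ ![u, v] → 0 < hopfCurvatureAt n t p u v)
    (i : Fin 3) (α β a b : ℝ) (h1 : α ≠ 0 ∨ a ≠ 0) (h2 : β ≠ 0 ∨ b ≠ 0) :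
    0 < horizontalH t i * (α * β) ^ 2 + verticalV t i * (a * b) ^ 2 + t (i + 1) ^ 2 * (a * β) ^ 2
      + t (i + 2) ^ 2 * (b * α) ^ 2
      + 6 * (t (i + 1) * t (i + 2) - t (i + 1) - t (i + 2) + t i) * (α * β) * (a * b) := by
  rw [← hopfCurvature_testPlane]
  -- Since `n ≥ 1` there are two distinct quaternionic coordinates: one carries `p`, the other a
  -- horizontal unit vector `q`.
  have hne : (0 : Fin (n + 1)) ≠ Fin.last n := by
    intro h; have := congrArg Fin.val h; simp at this; omega
  set p := coordVector n 0
  set q := coordVector n (Fin.last n)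
  have hp : ‖p‖ = 1 := norm_coordVector 0
  have hq : ‖q‖ = 1 := norm_coordVector _
  have hpq : ⟪p, q⟫_ℝ = 0 := inner_coordVector_of_ne hne
  have hξq (j : Fin 3) : ⟪fibreField n j p, q⟫_ℝ = 0 := inner_fibreField_coordVector_of_ne j hne
  have hpqi : ⟪p, fibreField n i q⟫_ℝ = 0 := by
    rw [real_inner_comm, inner_fibreField_left, hξq, neg_zero]
  have hξqi (j : Fin 3) : ⟪fibreField n j p, fibreField n i q⟫_ℝ = 0 := by
    have h01 (z w : QSpace n) := inner_fibreField_succ 0 z w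
    have h12 (z w : QSpace n) := inner_fibreField_succ 1 z w
    have h20 (z w : QSpace n) := inner_fibreField_succ 2 z w
    have h10 (z w : QSpace n) := inner_fibreField_succ_left 0 z w
    have h21 (z w : QSpace n) := inner_fibreField_succ_left 1 z w
    have h02 (z w : QSpace n) := inner_fibreField_succ_left 2 z w
    simp only [zero_add, show (1 : Fin 3) + 1 = 2 from rfl, show (1 : Fin 3) + 2 = 0 from rfl,
      show (2 : Fin 3) + 1 = 0 from rfl, show (2 : Fin 3) + 2 = 1 from rfl] at *
    fin_cases i <;> fin_cases j <;>
      simp [h01, h12, h20, h10, h21, h02, inner_fibreField_fibreField, hpq, hξq]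
  have hs (c : ℝ) (k : Fin 3) : ∑ l, (Pi.single k c : Fin 3 → ℝ) l • fibreField n l p =
      c • fibreField n k p := by
    rw [Finset.sum_eq_single k] <;> simp +contextual
  have hself (j : Fin 3) : ⟪p, fibreField n j p⟫_ℝ = 0 := by
    rw [real_inner_comm, inner_fibreField_self]
  have hqq : ⟪q, fibreField n i q⟫_ℝ = 0 := by rw [real_inner_comm, inner_fibreField_self]
  have key := hopfCurvatureAt_add t p (α • q) (β • fibreField n i q) hp
    (fun j => by rw [real_inner_smul_right, hξq, mul_zero])
    (fun j => by rw [real_inner_smul_right, hξqi, mul_zero])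
    (by rw [real_inner_smul_right, hpq, mul_zero])
    (by rw [real_inner_smul_right, hpqi, mul_zero])
    (Pi.single (i + 1) a) (Pi.single (i + 2) b)
  have hθ : (fun j => ⟪fibreField n j (α • q), β • fibreField n i q⟫_ℝ) =
      Pi.single i (α * β) := by
    funext j
    rw [map_smul, real_inner_smul_left, real_inner_smul_right, inner_fibreField, hq]
    by_cases hij : j = i
    · subst hij; simp
    · simp [hij]
  have hX : ⟪α • q, α • q⟫_ℝ = α ^ 2 := by
    rw [real_inner_smul_left, real_inner_smul_right, real_inner_self_eq_norm_sq, hq]; ring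
  have hY : ⟪β • fibreField n i q, β • fibreField n i q⟫_ℝ = β ^ 2 := by
    rw [real_inner_smul_left, real_inner_smul_right, inner_fibreField, hq]; simp; ring
  have hZ : ⟪α • q, β • fibreField n i q⟫_ℝ = 0 := by
    rw [real_inner_smul_left, real_inner_smul_right, hqq]; ring
  rw [hθ, hX, hY, hZ, hs, hs] at key
  rw [← key]
  have hne12 : i + 1 ≠ i + 2 := by fin_cases i <;> decide
  have hqξ (j : Fin 3) : ⟪q, fibreField n j p⟫_ℝ = 0 := by rw [real_inner_comm, hξq]
  have hqξi (j : Fin 3) : ⟪fibreField n i q, fibreField n j p⟫_ℝ = 0 := by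
    rw [real_inner_comm, hξqi]
  have hne0 (w : QSpace n) (hw : ‖w‖ = 1) (j : Fin 3) : fibreField n j w ≠ 0 := by
    rw [← inner_self_ne_zero (𝕜 := ℝ), inner_fibreField, hw]; simp
  refine h p _ _ hp ?_ ?_ ?_
  · simp [inner_add_right, real_inner_smul_right, hpq, hself]
  · simp [inner_add_right, real_inner_smul_right, hpqi, hself]
  · rw [LinearIndependent.pair_iff]
    intro s r hsr
    -- Pairing the relation with `q`, `p eᵢ₊₁`, `q eᵢ`, `p eᵢ₊₂` isolates its coefficients.
    have e (w : QSpace n) := congrArg (fun z => ⟪z, w⟫_ℝ) hsr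
    simp only [inner_add_left, real_inner_smul_left, inner_zero_left] at e
    have e1 := e q
    have e2 := e (fibreField n (i + 1) p)
    have e3 := e (fibreField n i q)
    have e4 := e (fibreField n (i + 2) p)
    simp [hqξ, hqξi, hξq, hξqi, hqq, inner_fibreField_self, inner_fibreField, hq,
      hne12.symm, hne12, hne0 p hp, hne0 q hq] at e1 e2 e3 e4
    constructor
    · rcases h1 with h1 | h1
      · exact e1.resolve_right h1
      · exact e2.resolve_right h1
    · rcases h2 with h2 | h2
      · exact e3.resolve_right h2
      · exact e4.resolve_right h2

theorem hopfPositivityCondition_of_pos (hn : 1 ≤ n) (t : Fin 3 → ℝ) (ht : ∀ i, 0 < t i)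
    (h : ∀ p u v : QSpace n, ‖p‖ = 1 → ⟪p, u⟫_ℝ = 0 → ⟪p, v⟫_ℝ = 0 →
      LinearIndependent ℝ ![u, v] → 0 < hopfCurvatureAt n t p u v) :
    HopfPositivityCondition t := by
  intro i
  -- A vertical plane gives `Vᵢ`; the horizontal plane of `x` and `x eᵢ` gives `Hᵢ`.
  have hV : 0 < verticalV t i := by
    simpa using testPlane_pos hn t h i 0 0 1 1 (by simp) (by simp)
  have hH : 0 < horizontalH t i := by
    simpa using testPlane_pos hn t h i 1 1 0 0 (by simp) (by simp)
  refine ⟨hV, hH, ?_⟩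
  have hj := ht (i + 1)
  have hk := ht (i + 2)
  have hP := testPlane_pos hn t h i
  set M := t (i + 1) * t (i + 2) - t (i + 1) - t (i + 2) + t i
  generalize horizontalH t i = H at *
  generalize verticalV t i = V at *
  generalize t (i + 1) = tj at *
  generalize t (i + 2) = tk at *
  -- With `θᵢ = 1` and `|cᵢ| = q` the terms `Hθᵢ²` and `Vcᵢ²` agree, so the square completed in
  -- `two_variable_pos` vanishes.
  set q := √H / √V with hq
  have hH' := Real.sqrt_pos.2 hH
  have hV' := Real.sqrt_pos.2 hV
  have hq0 : 0 < q := div_pos hH' hV'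
  have hVq : V * q ^ 2 = H := by
    rw [hq, div_pow, Real.sq_sqrt hH.le, Real.sq_sqrt hV.le]; field_simp
  have hHq : √(H * V) * q = H := by
    rw [Real.sqrt_mul hH.le, hq]
    field_simp
    exact Real.sq_sqrt hH.le
  -- Given `|ab| = q`, this balances `tⱼ|a| = tₖ|b|`, so that `tⱼ²a² + tₖ²b²` attains its minimum
  -- `2tⱼtₖq`. The sign `σ` of `b` below produces both halves of the absolute value.
  set a := √(q * tk / tj) with ha
  have ha2 : a ^ 2 = q * tk / tj := Real.sq_sqrt (by positivity)
  have hσ (σ : ℝ) (hσ : σ ^ 2 = 1) : -(σ * (3 * M)) < tj * tk + √(H * V) := by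
    have := hP 1 1 a (σ * (tj * a / tk)) (by simp) (by simp)
    have e1 : a * (σ * (tj * a / tk)) = σ * q := by
      rw [show a * (σ * (tj * a / tk)) = σ * (tj * a ^ 2 / tk) by ring, ha2]; field_simp
    have e2 : tj ^ 2 * (a * 1) ^ 2 = tj * tk * q := by
      rw [mul_one, ha2]; field_simp
    have e3 : tk ^ 2 * (σ * (tj * a / tk) * 1) ^ 2 = tj * tk * q := by
      rw [mul_one, mul_pow, hσ, one_mul, div_pow, mul_pow, ha2]; field_simp
    rw [e1, e2, e3, mul_pow σ q, hσ] at this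
    have h2 : 0 < (2 * (tj * tk + √(H * V) + σ * (3 * M))) * q := by nlinarith
    have := pos_of_mul_pos_left h2 hq0.le
    linarith
  have h1 := hσ 1 (by norm_num)
  have h2 := hσ (-1) (by norm_num)
  have : |3 * M| < tj * tk + √(H * V) := abs_lt.2 ⟨by linarith, by linarith⟩
  rwa [abs_mul, abs_of_pos (by norm_num : (0 : ℝ) < 3)] at this

end TestPlanes

/-! ### Identification with the charts of the sphere -/

section Chart

variable {n : ℕ}

/-- The isometry onto the orthogonal complement of `p` used by the chart of the sphere at `p`. -/
noncomputable def chartIsometry (p : HopfSphere n) :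
    EuclideanSpace ℝ (Fin (4 * n + 3)) →ₗᵢ[ℝ] QSpace n :=
  (Submodule.subtypeₗᵢ (ℝ ∙ ((-p : HopfSphere n) : QSpace n))ᗮ).comp
    (OrthonormalBasis.fromOrthogonalSpanSingleton (4 * n + 3)
      (ne_zero_of_mem_unit_sphere (-p))).repr.symm.toLinearIsometry

theorem inner_chartIsometry (p : HopfSphere n) (x : EuclideanSpace ℝ (Fin (4 * n + 3))) :
    ⟪(p : QSpace n), chartIsometry p x⟫_ℝ = 0 := by
  have h := Submodule.mem_orthogonal_singleton_iff_inner_right.1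
    ((OrthonormalBasis.fromOrthogonalSpanSingleton (4 * n + 3)
      (ne_zero_of_mem_unit_sphere (-p))).repr.symm x).2
  have h' : ⟪-(p : QSpace n), chartIsometry p x⟫_ℝ = 0 := h
  rwa [inner_neg_left, neg_eq_zero] at h'

theorem exists_chartIsometry_eq (p : HopfSphere n) (w : QSpace n) (hw : ⟪(p : QSpace n), w⟫_ℝ = 0) :
    ∃ x, chartIsometry p x = w := by
  have hmem : w ∈ (ℝ ∙ ((-p : HopfSphere n) : QSpace n))ᗮ := by
    rw [Submodule.mem_orthogonal_singleton_iff_inner_right]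
    change ⟪-(p : QSpace n), w⟫_ℝ = 0
    rw [inner_neg_left, hw, neg_zero]
  refine ⟨(OrthonormalBasis.fromOrthogonalSpanSingleton (4 * n + 3)
      (ne_zero_of_mem_unit_sphere (-p))).repr ⟨w, hmem⟩, ?_⟩
  exact congrArg Subtype.val (LinearIsometryEquiv.symm_apply_apply _ (⟨w, hmem⟩ : (ℝ ∙ _)ᗮ))

/-- The chart at `p` is stereographic projection from `-p`; the two formulas agree because `(|x|² -
4)/(|x|² + 4) = 1 - 8/(|x|² + 4)`. -/
theorem coe_extChartAt_symm (p : HopfSphere n) (x : EuclideanSpace ℝ (Fin (4 * n + 3))) :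
    (((extChartAt (𝓡 (4 * n + 3)) p).symm x : HopfSphere n) : QSpace n) =
      stereoParam (chartIsometry p) p x := by
  have h := stereographic'_symm_apply (n := 4 * n + 3) (-p) x
  have h0 : (((extChartAt (𝓡 (4 * n + 3)) p).symm x : HopfSphere n) : QSpace n) =
    (((stereographic' (4 * n + 3) (-p)).symm x : HopfSphere n) : QSpace n) := rfl
  rw [h0, h]
  change (‖chartIsometry p x‖ ^ 2 + 4)⁻¹ • (4 : ℝ) • chartIsometry p x
    + (‖chartIsometry p x‖ ^ 2 + 4)⁻¹ • (‖chartIsometry p x‖ ^ 2 - 4) • (-(p : QSpace n)) = _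
  rw [LinearIsometry.norm_map, stereoParam]
  have hr : (‖x‖ ^ 2 + 4)⁻¹ * (‖x‖ ^ 2 + 4) = 1 := inv_mul_cancel₀ (by positivity)
  have : (‖x‖ ^ 2 + 4)⁻¹ * (‖x‖ ^ 2 - 4) = 1 - 8 * (‖x‖ ^ 2 + 4)⁻¹ := by linarith
  rw [smul_smul _ (‖x‖ ^ 2 - 4), this]
  module

theorem extChartAt_target_sphere (p : HopfSphere n) :
    (extChartAt (𝓡 (4 * n + 3)) p).target = Set.univ := by
  have h : (chartAt (EuclideanSpace ℝ (Fin (4 * n + 3))) p).target = Set.univ :=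
    stereographic'_target (-p)
  simp [h]

theorem extChartAt_self_sphere (p : HopfSphere n) : extChartAt (𝓡 (4 * n + 3)) p p = 0 := by
  have h1 := stereographic_apply_neg (-p)
  rw [neg_neg] at h1
  change (OrthonormalBasis.fromOrthogonalSpanSingleton (4 * n + 3)
    (ne_zero_of_mem_unit_sphere (-p))).repr
      (stereographic (norm_eq_of_mem_sphere (-p)) p) = 0
  rw [h1, map_zero]

theorem tangentInclusion_mfderiv_extChartAt_symm (p : HopfSphere n)
    (x u : EuclideanSpace ℝ (Fin (4 * n + 3))) :
    tangentInclusion n ((extChartAt (𝓡 (4 * n + 3)) p).symm x)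
      (mfderiv (𝓡 (4 * n + 3)) (𝓡 (4 * n + 3)) (extChartAt (𝓡 (4 * n + 3)) p).symm x u) =
      fderiv ℝ (stereoParam (chartIsometry p) p) x u := by
  have h1 : MDifferentiableAt (𝓡 (4 * n + 3)) (𝓡 (4 * n + 3))
      (extChartAt (𝓡 (4 * n + 3)) p).symm x := by
    have := mdifferentiableWithinAt_extChartAt_symm (I := 𝓡 (4 * n + 3)) (x := p) (z := x)
      (by rw [extChartAt_target_sphere]; trivial)
    simpa [mdifferentiableWithinAt_univ] using this
  have h2 : MDifferentiableAt (𝓡 (4 * n + 3)) 𝓘(ℝ, QSpace n) ((↑) : HopfSphere n → QSpace n)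
      ((extChartAt (𝓡 (4 * n + 3)) p).symm x) :=
    (contMDiff_coe_sphere (m := ∞)).mdifferentiableAt (by simp)
  have h3 := mfderiv_comp x h2 h1
  have h4 : ((↑) : HopfSphere n → QSpace n) ∘ (extChartAt (𝓡 (4 * n + 3)) p).symm =
      stereoParam (chartIsometry p) p := funext (coe_extChartAt_symm p)
  rw [h4, mfderiv_eq_fderiv] at h3
  exact (congrArg (fun L => L u) h3).symm

theorem coordMetric_hopfMetric (t : Fin 3 → ℝ) (ht : ∀ i, 0 < t i) (p : HopfSphere n) :
    coordMetric (hopfMetric n t ht) p = stereoMetric t (chartIsometry p) p := by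
  funext x
  ext u v
  have h1 := tangentInclusion_mfderiv_extChartAt_symm p x u
  have h2 := tangentInclusion_mfderiv_extChartAt_symm p x v
  rw [stereoMetric, pullbackForm_apply, ← coe_extChartAt_symm, ← h1, ← h2]
  rfl

/-- Strict Cauchy–Schwarz, from positivity of `B` on `B(v, v)u - B(u, v)v`. It makes the denominator
of the sectional curvature positive, so only the numerator decides the sign. -/
theorem sq_lt_mul_of_pos {E : Type*} [AddCommGroup E] [Module ℝ E] [TopologicalSpace E]
    (B : E →L[ℝ] E →L[ℝ] ℝ) (hs : ∀ u v, B u v = B v u) (hB : ∀ u, u ≠ 0 → 0 < B u u) {u v : E}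
    (huv : LinearIndependent ℝ ![u, v]) : 0 < B u u * B v v - B u v ^ 2 := by
  rw [LinearIndependent.pair_iff] at huv
  have hv : v ≠ 0 := by
    rintro rfl
    exact one_ne_zero (huv 0 1 (by simp)).2
  have h := hB (B v v • u - B u v • v) fun h0 => (hB v hv).ne'
    (huv (B v v) (-B u v) (by rw [neg_smul, ← sub_eq_add_neg, h0])).1
  simp only [map_sub, map_smul, sub_apply, smul_apply, smul_eq_mul, hs v u] at h
  refine pos_of_mul_pos_right (a := B v v) ?_ (hB v hv).le
  linarith

theorem sectionalCurvatureOfForm_stereoMetric_pos_iff (t : Fin 3 → ℝ) (ht : ∀ i, 0 < t i)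
    (p : HopfSphere n) {u v : EuclideanSpace ℝ (Fin (4 * n + 3))}
    (huv : LinearIndependent ℝ ![u, v]) :
    0 < sectionalCurvatureOfForm (stereoMetric t (chartIsometry p) p) 0 u v ↔
      0 < hopfCurvatureAt n t p (chartIsometry p u) (chartIsometry p v) := by
  have hp : ‖(p : QSpace n)‖ = 1 := norm_eq_of_mem_sphere p
  have hden := sq_lt_mul_of_pos (stereoMetric t (chartIsometry p) p 0)
    (fun u v => by
      rw [stereoMetric_zero, stereoMetric_zero, ambientForm_apply, ambientForm_apply,
        real_inner_comm]
      simp only [mul_comm])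
    (fun u hu => by
      rw [stereoMetric_zero]
      exact ambientForm_pos n t ht p hp _
        ((map_ne_zero_iff _ (chartIsometry p).injective).2 hu)) huv
  rw [sectionalCurvatureOfForm, div_pos_iff_of_pos_right hden,
    riemannTensor_stereoMetric t ht (chartIsometry p) p hp (inner_chartIsometry p)
      (exists_chartIsometry_eq p) u v _ _ _ (fun _ => rfl) (fun _ => rfl) fun _ => rfl,
    hopfCurvatureAt]

/-- The differential of the chart followed by `chartIsometry` is an isomorphism from the tangent
space onto the complement of `p`, so tangent planes correspond to planes orthogonal to `p`. -/
theorem hasPositiveSectionalCurvature_hopfMetric_iff (t : Fin 3 → ℝ) (ht : ∀ i, 0 < t i) :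
    HasPositiveSectionalCurvature (hopfMetric n t ht) ↔
      ∀ p u v : QSpace n, ‖p‖ = 1 → ⟪p, u⟫_ℝ = 0 → ⟪p, v⟫_ℝ = 0 →
        LinearIndependent ℝ ![u, v] → 0 < hopfCurvatureAt n t p u v := by
  have hpair {F F' : Type} [AddCommGroup F] [Module ℝ F] [AddCommGroup F'] [Module ℝ F']
      (f : F →ₗ[ℝ] F') (hf : Function.Injective f) (u v : F) :
      LinearIndependent ℝ ![f u, f v] ↔ LinearIndependent ℝ ![u, v] := by
    have h : ![f u, f v] = f ∘ ![u, v] := by funext i; fin_cases i <;> rfl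
    rw [h, LinearMap.linearIndependent_iff f (LinearMap.ker_eq_bot.2 hf)]
  have hinv (p : HopfSphere n) := isInvertible_mfderiv_extChartAt (I := 𝓡 (4 * n + 3))
    (mem_extChartAt_source (I := 𝓡 (4 * n + 3)) p)
  constructor
  · intro h p u v hp hu hv huv
    let P : HopfSphere n := ⟨p, by simpa using hp⟩
    obtain ⟨u', rfl⟩ := exists_chartIsometry_eq P u hu
    obtain ⟨v', rfl⟩ := exists_chartIsometry_eq P v hv
    have huv' : LinearIndependent ℝ ![u', v'] :=
      (hpair (chartIsometry P).toLinearMap (chartIsometry P).injective u' v').1 huv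
    obtain ⟨u, rfl⟩ := (hinv P).surjective u'
    obtain ⟨v, rfl⟩ := (hinv P).surjective v'
    have := h P u v ((hpair (F := EuclideanSpace ℝ (Fin (4 * n + 3)))
      (F' := EuclideanSpace ℝ (Fin (4 * n + 3))) (ContinuousLinearMap.toLinearMap _)
      (hinv P).injective u v).1 huv')
    rw [sectionalCurvature, coordMetric_hopfMetric, extChartAt_self_sphere] at this
    exact (sectionalCurvatureOfForm_stereoMetric_pos_iff t ht P huv').1 this
  · intro h p u v huv
    have huv' := (hpair (F := EuclideanSpace ℝ (Fin (4 * n + 3)))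
      (F' := EuclideanSpace ℝ (Fin (4 * n + 3))) (ContinuousLinearMap.toLinearMap _)
      (hinv p).injective u v).2 huv
    rw [sectionalCurvature, coordMetric_hopfMetric, extChartAt_self_sphere]
    refine (sectionalCurvatureOfForm_stereoMetric_pos_iff t ht p huv').2
      (h p _ _ (norm_eq_of_mem_sphere p) (inner_chartIsometry p _) (inner_chartIsometry p _) ?_)
    exact (hpair (chartIsometry p).toLinearMap (chartIsometry p).injective _ _).2 huv'

end Chart

theorem theoremB (n : ℕ) (hn : 1 ≤ n) (t : Fin 3 → ℝ) (ht : ∀ i, 0 < t i) :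
    HasPositiveSectionalCurvature (hopfMetric n t ht) ↔
      ∀ i : Fin 3, 0 < verticalV t i ∧ 0 < horizontalH t i ∧
        3 * |t (i + 1) * t (i + 2) - t (i + 1) - t (i + 2) + t i| <
          t (i + 1) * t (i + 2) + √(horizontalH t i * verticalV t i) := by
  rw [hasPositiveSectionalCurvature_hopfMetric_iff]
  exact ⟨hopfPositivityCondition_of_pos hn t ht, fun hc p u v hp hu hv huv =>
    hopfCurvatureAt_pos t ht hc p u v hp hu hv huv⟩
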